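/- Let $n,T\ge 1$ be integers, let $\mathcal K\subset\mathbb R^n$ be convex and compact, and let $\mathcal B$ and $\mathcal S$ be the closed Euclidean unit ball and the unit sphere of $\mathbb R^n$. Let $0<r$, $0<R$ satisfy $r\mathcal B\subseteq\mathcal K\subseteq R\mathcal B$. Let $f_1,\dots,f_T$ be real-valued functions on $\mathbb R^n$, fixed in advance (oblivious losses), that on $R\mathcal B$ are convex, bounded in absolute value by $M>0$, and $G_f$-Lipschitz. The set $\mathcal K$ is accessed through a (measurable) separation oracle: queried at $y$, it certifies that $y\in\mathcal K$ if this is so, and otherwise it returns a vector $g$ with $(y-x)^\top g>0$ for all $x\in\mathcal K$. **Infeasible projection** with parameters $(\delta,\delta')$, started at $y_0$: set $y_1=y_0/\max\{1,\|y_0\|/R\}$; for $i=1,2,\dots$ query the oracle at $y_i/(1-\delta'/r)$; if this point is certified to lie in $\mathcal K$, return $y_i$; otherwise, with $g_i$ the returned vector, set $y_{i+1}=y_i-\frac{\delta(r-\delta')}{\|g_i\|}g_i$. **Algorithm SO-BGD** with parameters $(\eta,\delta,\delta')$: set $\tilde y_1=0$. In round $t=1,\dots,T$ draw $u_t$ uniformly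 from $\mathcal S$, independently of the other rounds, play $z_t=\tilde y_t+\delta'u_t$, observe $f_t(z_t)$, set $g_t=\frac n{\delta'}f_t(z_t)u_t$ and $y_{t+1}=\tilde y_t-\eta g_t$, and let $\tilde y_{t+1}$ be the output of the infeasible projection with parameters $(\delta,\delta')$ started at $y_{t+1}$. Let $N_{calls}$ be the overall number of oracle calls in the $T$ rounds, and let $$AER_T=\sup_{1\le s\le e\le T}\Big\{\mathbb E\Big[\sum_{t=s}^e f_t(z_t)\Big]-\min_{x\in\mathcal K}\sum_{t=s}^e f_t(x)\Big\}$$ be the adaptive expected regret. Let $c,c'>0$ satisfy $2c'T^{-1/4}<r$ and $cT^{-1/4}<1$, and set $\eta=\frac{r}{4\sqrt{nM}}T^{-3/4}$, $\delta=cT^{-1/4}$, $\delta'=c'T^{-1/4}$. Then every run of the infeasible projection terminates, $z_t\in\mathcal K$ for all $t\in\{1,\dots,T\}$, $$AER_T\le\Big(3G_fc'+\frac{G_fRc'}{r}+G_fRc+\frac{8R^2\sqrt{nM}}{r}+\frac{(nM)^{3/2}r}{8c'^2}\Big)T^{3/4}+\frac{G_fRcc'}{r}T^{1/2},$$ and $$N_{calls}\le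 T+\frac{2R\sqrt{nM}}{r}\frac1{cc'}T^{3/4}+\frac{nM}{4}\frac1{c^2c'^2}T^{1/2}$$ for every realization of the $u_t$. In particular, if $T^{1/4}>\max\{\frac{2\sqrt{nM}}r,\frac8r\}$, then with $c=\frac8r$ and $c'=\sqrt{nM}$ the algorithm is feasible as above and $$AER_T\le R\sqrt{nM}\Big(\frac{4G_f}{r}+\frac{8R}{r}+\frac{r}{8R}\Big)T^{3/4}+\frac{8G_fR}{r}T^{3/4}+\frac{8G_fR\sqrt{nM}}{r^2}T^{1/2},$$ $$N_{calls}\le T+\frac R4T^{3/4}+\frac{r^2}{256}T^{1/2}.$$ -/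

import Mathlib

open MeasureTheory ProbabilityTheory

/-- `ℝⁿ` with the Euclidean norm. -/
abbrev Euc (n : ℕ) : Type := EuclideanSpace ℝ (Fin n)

/-- The uniform probability distribution on the unit sphere of `ℝⁿ` (`n ≥ 1`):
the surface measure, normalized to total mass one. -/
noncomputable def uniformSphere (n : ℕ) : Measure (Metric.sphere (0 : Euc n) 1) :=
  ((volume : Measure (Euc n)).toSphere Set.univ)⁻¹ • (volume : Measure (Euc n)).toSphere

/-- A separation oracle for `K`: on a query `y` it answers `none` if `y ∈ K` (it certifies that `y`
is feasible), and otherwise returns a vector `g` such that `(y - x)ᵀ g > 0` for all `x ∈ K`. -/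
structure IsSeparationOracle {n : ℕ} (K : Set (Euc n)) (so : Euc n → Option (Euc n)) : Prop where
  feasible : ∀ y ∈ K, so y = none
  separates : ∀ y, y ∉ K → ∃ g, so y = some g ∧ ∀ x ∈ K, 0 < inner ℝ (y - x) g

/-- The inputs of the bandit algorithm SO-BGD: the separation oracle, the radii `r ≤ R` with
`rB ⊆ K ⊆ RB`, the step size `η` and the two squeeze parameters `δ`, `δ'`. -/
structure SOBGD (n : ℕ) where
  so : Euc n → Option (Euc n)
  r : ℝ
  R : ℝ
  η : ℝ
  δ : ℝ
  δ' : ℝ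

namespace SOBGD

variable {n : ℕ} (P : SOBGD n)

/-! ### Infeasible projection via a separation oracle -/

/-- The oracle call made at the current point `y`: the oracle is queried at `y / (1 - δ'/r)`. -/
noncomputable def ask (y : Euc n) : Option (Euc n) :=
  P.so ((1 - P.δ' / P.r)⁻¹ • y)

/-- One pass of the loop: if the oracle returns a hyperplane `g`, move to `y - γ g` with
`γ = δ (r - δ') / ‖g‖`. If it reports feasibility the loop has stopped; the point is kept. -/
noncomputable def pull (y : Euc n) : Euc n :=
  match P.ask y with
  | none => y
  | some g => y - (P.δ * (P.r - P.δ') / ‖g‖) • g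

/-- The iterates of the loop started at `y₀`; the first one is the Euclidean projection of `y₀`
onto the ball of radius `R`. -/
noncomputable def projIter (y₀ : Euc n) : ℕ → Euc n
  | 0 => (max 1 (‖y₀‖ / P.R))⁻¹ • y₀
  | i + 1 => P.pull (projIter y₀ i)

/-- The loop stops at its `i`-th iterate (counted from `0`). -/
def ProjStopsAt (y₀ : Euc n) (i : ℕ) : Prop := P.ask (P.projIter y₀ i) = none

/-- The loop started at `y₀` stops after finitely many passes. -/
def ProjTerminates (y₀ : Euc n) : Prop := ∃ i, P.ProjStopsAt y₀ i

/-- The index of the first iterate that the oracle certifies as feasible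
(meaningful when the loop terminates). -/
noncomputable def projStop (y₀ : Euc n) : ℕ := sInf {i | P.ProjStopsAt y₀ i}

/-- The point returned by the loop. -/
noncomputable def projOutput (y₀ : Euc n) : Euc n := P.projIter y₀ (P.projStop y₀)

/-- The number of oracle calls made by the loop: one for each of the iterates
`0, …, projStop y₀`. -/
noncomputable def projCalls (y₀ : Euc n) : ℕ := P.projStop y₀ + 1

/-! ### The online algorithm

Rounds are numbered `t = 0, …, T - 1`; `f t` is the loss and `u t` the sampled direction of round
`t`. -/

/-- The point played from the iterate `y` with direction `v`. -/
noncomputable def perturb (y v : Euc n) : Euc n := y + P.δ' • v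

/-- The gradient step `y - η g` with the one-point estimate `g = (n/δ') h(z) v`, `z = y + δ' v`. -/
noncomputable def gradStep (h : Euc n → ℝ) (y v : Euc n) : Euc n :=
  y - P.η • ((n / P.δ' * h (P.perturb y v)) • v)

/-- The iterate `ỹ` of round `t`. -/
noncomputable def iterate (f : ℕ → Euc n → ℝ) (u : ℕ → Metric.sphere (0 : Euc n) 1) : ℕ → Euc n
  | 0 => 0
  | t + 1 => P.projOutput (P.gradStep (f t) (iterate f u t) (u t))

/-- The point `z` played in round `t`. -/
noncomputable def play (f : ℕ → Euc n → ℝ) (u : ℕ → Metric.sphere (0 : Euc n) 1) (t : ℕ) : Euc n :=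
  P.perturb (P.iterate f u t) (u t)

/-- The point that is handed to the infeasible projection at the end of round `t`. -/
noncomputable def target (f : ℕ → Euc n → ℝ) (u : ℕ → Metric.sphere (0 : Euc n) 1) (t : ℕ) :
    Euc n :=
  P.gradStep (f t) (P.iterate f u t) (u t)

/-- The overall number of oracle calls in `T` rounds. -/
noncomputable def calls (f : ℕ → Euc n → ℝ) (u : ℕ → Metric.sphere (0 : Euc n) 1) (T : ℕ) : ℕ :=
  ∑ t ∈ Finset.range T, P.projCalls (P.target f u t)

end SOBGD

/-- Adaptive expected regret of the random plays `z` with respect to the feasible set `K` and the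
losses `f`: the supremum over all intervals `[s, e]` of rounds of
`E[∑_{t=s}^e f_t(z_t)] - min_{x ∈ K} ∑_{t=s}^e f_t(x)`. -/
noncomputable def adaptiveExpectedRegret {n : ℕ} {Ω : Type*} [MeasurableSpace Ω] (μ : Measure Ω)
    (K : Set (Euc n)) (f : ℕ → Euc n → ℝ) (z : ℕ → Ω → Euc n) (T : ℕ) : ℝ :=
  ⨆ I : {p : Fin T × Fin T // p.1 ≤ p.2},
    ((∫ ω, ∑ t ∈ Finset.Icc I.1.1 I.1.2, f t (z t ω) ∂μ)
      - ⨅ x : K, ∑ t ∈ Finset.Icc I.1.1 I.1.2, f t x)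

/-- SO-BGD with `η = r T^(-3/4) / (4 √(nM))`, `δ = c T^(-1/4)`, `δ' = c' T^(-1/4)`. -/
noncomputable def tunedSOBGD {n : ℕ} (so : Euc n → Option (Euc n)) (r R M : ℝ) (T : ℕ)
    (c c' : ℝ) : SOBGD n where
  so := so
  r := r
  R := R
  η := r / (4 * √(n * M)) * (T : ℝ) ^ (-(3 / 4) : ℝ)
  δ := c * (T : ℝ) ^ (-(1 / 4) : ℝ)
  δ' := c' * (T : ℝ) ^ (-(1 / 4) : ℝ)

/-- What is guaranteed for a run of SO-BGD driven by the random directions `u`: in each outcome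
every projection subroutine terminates, every played point is feasible and the number of oracle
calls is at most `callBound`; the losses of the plays are integrable and the adaptive expected
regret is at most `regretBound`. -/
structure SOBGD.Guarantee {n : ℕ} (P : SOBGD n) {Ω : Type*} [MeasurableSpace Ω] (μ : Measure Ω)
    (K : Set (Euc n)) (f : ℕ → Euc n → ℝ) (u : ℕ → Ω → Metric.sphere (0 : Euc n) 1) (T : ℕ)
    (regretBound callBound : ℝ) : Prop where
  terminates : ∀ ω, ∀ t < T, P.ProjTerminates (P.target f (fun i => u i ω) t)
  feasible : ∀ ω, ∀ t < T, P.play f (fun i => u i ω) t ∈ K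
  calls_le : ∀ ω, (P.calls f (fun i => u i ω) T : ℝ) ≤ callBound
  integrable : ∀ t < T, Integrable (fun ω => f t (P.play f (fun i => u i ω) t)) μ
  regret_le :
    adaptiveExpectedRegret μ K f (fun t ω => P.play f (fun i => u i ω) t) T ≤ regretBound

/-! Write σ = 1 - δ'/r. A cut `g` at `y` separates `y` from σK, and since rB ⊆ K it does so with
margin a(r-δ')‖g‖ from (1-a)σK (`Admissible.margin`). For a = δ the margin matches the step length,
so cuts never increase the distance to the comparators (1-δ)σx. For a = 1 the comparator is 0, and
each cut lowers ‖y‖² by at least δ(r-δ')². Hence the loop terminates, and ‖ỹ‖² is a potential that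
pays for all oracle calls (`Admissible.calls_le`). The output lies in σK, and σK + δ'B ⊆ K, so plays
are feasible.

For the regret, the usual gradient-descent telescoping bounds the linearized losses along each run,
over any interval of rounds. Since ỹ_t depends only on earlier directions, conditioning on it leaves
a single sphere average, and `sub_le_integral_onePoint` shows that this average is at least f(ỹ) -
f(z) - 2Gδ'. That estimate needs no gradient of a smoothed loss: integrating by parts against the
cones (1-‖x‖)⁺ and (ρ-‖x‖)⁺ and letting ρ → 1 turns the sphere average into a ball average of a
directional derivative, which convexity bounds by a difference of values.

Losses are controlled only on the ball RB, but a run sees them only on K, so they may be replaced by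
globally Lipschitz extensions. The parameter choice then gives the stated rates. -/

namespace SOBGD

/-! ### Geometry of the infeasible projection. -/

variable {n : ℕ}

/-- The conditions on the parameters, the feasible set and the oracle under which the infeasible
projection of SO-BGD is analysed. -/
structure Admissible (P : SOBGD n) (K : Set (Euc n)) : Prop where
  convex : Convex ℝ K
  oracle : IsSeparationOracle K P.so
  r_pos : 0 < P.r
  R_pos : 0 < P.R
  δ_pos : 0 < P.δ
  δ_lt : P.δ < 1
  δ'_pos : 0 < P.δ'
  δ'_lt : P.δ' < P.r
  ball_subset : Metric.closedBall 0 P.r ⊆ K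
  subset_ball : K ⊆ Metric.closedBall 0 P.R

/-- The factor `1 - δ'/r` by which the feasible set is shrunk. -/
noncomputable def shrink (P : SOBGD n) : ℝ := 1 - P.δ' / P.r

/-- Expanding the square with ‖v‖ = 1. The cross term is kept exact because its expectation is what
carries the regret. -/
theorem norm_gradStep_sub_sq (P : SOBGD n) {φ : Euc n → ℝ} (y z : Euc n)
    (v : Metric.sphere (0 : Euc n) 1) {M : ℝ} (hM : |φ (P.perturb y v)| ≤ M) :
    ‖P.gradStep φ y v - z‖ ^ 2 ≤ ‖y - z‖ ^ 2
      - 2 * P.η * (n / P.δ' * φ (P.perturb y v) * inner ℝ (v : Euc n) (y - z))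
      + P.η ^ 2 * (n / P.δ' * M) ^ 2 := by
  have h1 : P.gradStep φ y v - z
      = (y - z) - (P.η * (n / P.δ' * φ (P.perturb y v))) • (v : Euc n) := by
    rw [gradStep, smul_smul]; abel
  have h2 : (n / P.δ' * φ (P.perturb y v)) ^ 2 ≤ (n / P.δ' * M) ^ 2 := by
    rw [mul_pow, mul_pow]
    exact mul_le_mul_of_nonneg_left
      (sq_le_sq' (neg_le_of_abs_le hM) (le_of_abs_le hM)) (sq_nonneg _)
  rw [h1, norm_sub_sq_real, real_inner_smul_right, norm_smul, norm_eq_of_mem_sphere v, mul_one,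
    real_inner_comm, Real.norm_eq_abs, sq_abs, mul_pow]
  nlinarith [mul_le_mul_of_nonneg_left h2 (sq_nonneg P.η)]

namespace Admissible

variable {P : SOBGD n} {K : Set (Euc n)}

theorem shrink_pos (h : P.Admissible K) : 0 < P.shrink := by
  have := (div_lt_one h.r_pos).2 h.δ'_lt
  unfold shrink; linarith

theorem shrink_le_one (h : P.Admissible K) : P.shrink ≤ 1 := by
  have := div_pos h.δ'_pos h.r_pos
  unfold shrink; linarith

theorem shrink_mul_r (h : P.Admissible K) : P.shrink * P.r = P.r - P.δ' := by
  have := h.r_pos.ne'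
  unfold shrink; field_simp

theorem zero_mem (h : P.Admissible K) : (0 : Euc n) ∈ K :=
  h.ball_subset (by simpa using h.r_pos.le)

theorem mem_of_norm_le (h : P.Admissible K) {x : Euc n} (hx : ‖x‖ ≤ P.r) : x ∈ K :=
  h.ball_subset (by simpa using hx)

theorem norm_le (h : P.Admissible K) {x : Euc n} (hx : x ∈ K) : ‖x‖ ≤ P.R := by
  simpa using h.subset_ball hx

theorem ask_eq_none_iff (h : P.Admissible K) (y : Euc n) : P.ask y = none ↔ P.shrink⁻¹ • y ∈ K := by
  constructor
  · intro hy
    by_contra hK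
    obtain ⟨g, hg, -⟩ := h.oracle.separates _ hK
    simp [ask, shrink] at hy hg
    simp [hy] at hg
  · exact h.oracle.feasible _

theorem inner_lt_of_ask (h : P.Admissible K) {y g : Euc n} (hg : P.ask y = some g) {x : Euc n}
    (hx : x ∈ K) :
    inner ℝ (P.shrink • x) g < inner ℝ y g := by
  have hy : P.shrink⁻¹ • y ∉ K := by
    rw [← h.ask_eq_none_iff, hg]; simp
  obtain ⟨g', hg', hsep⟩ := h.oracle.separates _ hy
  have : g' = g := by
    have : P.ask y = some g' := hg'
    rw [hg] at this; exact (Option.some.inj this).symm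
  subst this
  have h1 := mul_pos h.shrink_pos (hsep x hx)
  rw [inner_sub_left, mul_sub, ← real_inner_smul_left, ← real_inner_smul_left,
    smul_inv_smul₀ h.shrink_pos.ne'] at h1
  linarith

theorem ne_zero_of_ask (h : P.Admissible K) {y g : Euc n} (hg : P.ask y = some g) : g ≠ 0 := by
  rintro rfl
  simpa using h.inner_lt_of_ask hg h.zero_mem

/-- A cut separates with a margin from the points of the set shrunk by a further factor. -/
theorem margin (h : P.Admissible K) {y g : Euc n} (hg : P.ask y = some g) {x : Euc n} (hx : x ∈ K)
    {a : ℝ}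
    (ha0 : 0 ≤ a) (ha1 : a ≤ 1) :
    a * (P.r - P.δ') * ‖g‖ ≤ inner ℝ (y - ((1 - a) * P.shrink) • x) g := by
  have hg0 : 0 < ‖g‖ := norm_pos_iff.2 (h.ne_zero_of_ask hg)
  have hr := h.r_pos
  -- The point of rB farthest in direction `g`; mixing it into `x` with weight `a` is what produces
  -- the margin.
  have h1 : (P.r / ‖g‖) • g ∈ K := by
    apply h.mem_of_norm_le
    rw [norm_smul, Real.norm_of_nonneg (by positivity)]
    field_simp; rfl
  have h2 : (1 - a) • x + a • ((P.r / ‖g‖) • g) ∈ K :=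
    h.convex hx h1 (by linarith) ha0 (by ring)
  have h3 := h.inner_lt_of_ask hg h2
  rw [smul_add, inner_add_left, smul_smul, smul_smul, smul_smul, real_inner_smul_left,
    real_inner_smul_left, real_inner_self_eq_norm_sq] at h3
  rw [inner_sub_left, real_inner_smul_left, ← h.shrink_mul_r]
  have h4 : P.shrink * a * (P.r / ‖g‖) * ‖g‖ ^ 2 = a * (P.shrink * P.r) * ‖g‖ := by
    field_simp
  rw [h4] at h3
  nlinarith [h3]

theorem norm_pull_sub_sq (h : P.Admissible K) {y g : Euc n} (hg : P.ask y = some g) (z : Euc n)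
    {m : ℝ}
    (hm : m * ‖g‖ ≤ inner ℝ (y - z) g) :
    ‖P.pull y - z‖ ^ 2 ≤ ‖y - z‖ ^ 2 - 2 * (P.δ * (P.r - P.δ')) * m
      + (P.δ * (P.r - P.δ')) ^ 2 := by
  have hg0 : 0 < ‖g‖ := norm_pos_iff.2 (h.ne_zero_of_ask hg)
  have hs : 0 < P.δ * (P.r - P.δ') := mul_pos h.δ_pos (sub_pos.2 h.δ'_lt)
  have hp : P.pull y - z = (y - z) - (P.δ * (P.r - P.δ') / ‖g‖) • g := by
    simp only [pull, hg]
    abel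
  generalize P.δ * (P.r - P.δ') = s at *
  rw [hp, norm_sub_sq_real, real_inner_smul_right, norm_smul, Real.norm_of_nonneg (by positivity)]
  have h1 : s / ‖g‖ * ‖g‖ = s := by field_simp
  have h2 : s * m ≤ s / ‖g‖ * inner ℝ (y - z) g := by
    calc s * m = s / ‖g‖ * (m * ‖g‖) := by field_simp
      _ ≤ _ := by gcongr
  rw [h1]; linarith

/-- With a = δ the margin m equals the step length s, so the squared distance changes by at most
-2s² + s² ≤ 0. -/
theorem norm_pull_sub_le (h : P.Admissible K) (y : Euc n) {x : Euc n} (hx : x ∈ K) :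
    ‖P.pull y - ((1 - P.δ) * P.shrink) • x‖ ≤ ‖y - ((1 - P.δ) * P.shrink) • x‖ := by
  cases hg : P.ask y with
  | none => simp [pull, hg]
  | some g =>
    have h1 := h.norm_pull_sub_sq hg _ (h.margin hg hx h.δ_pos.le h.δ_lt.le)
    refine (pow_le_pow_iff_left₀ (norm_nonneg _) (norm_nonneg _) two_ne_zero).1 ?_
    nlinarith [h1, sq_nonneg (P.δ * (P.r - P.δ'))]

/-- With a = 1 and x = 0 the margin is r - δ', and the decrease (2δ - δ²)(r-δ')² is at least
δ(r-δ')² because δ < 1. -/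
theorem norm_pull_sq_le (h : P.Admissible K) {y : Euc n} (hy : P.ask y ≠ none) :
    ‖P.pull y‖ ^ 2 ≤ ‖y‖ ^ 2 - P.δ * (P.r - P.δ') ^ 2 := by
  obtain ⟨g, hg⟩ := Option.ne_none_iff_exists'.1 hy
  have h0 := h.margin hg h.zero_mem zero_le_one le_rfl
  have h1 := h.norm_pull_sub_sq hg 0 (m := P.r - P.δ') (by simpa using h0)
  simp only [sub_zero] at h1
  have h2 : P.δ ^ 2 * (P.r - P.δ') ^ 2 ≤ P.δ * (P.r - P.δ') ^ 2 := by
    gcongr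
    nlinarith [h.δ_pos, h.δ_lt]
  nlinarith [h1, h2]

theorem norm_projIter_zero_sub_le (h : P.Admissible K) (y₀ : Euc n) {z : Euc n} (hz : ‖z‖ ≤ P.R) :
    ‖P.projIter y₀ 0 - z‖ ≤ ‖y₀ - z‖ := by
  have hR := h.R_pos
  rcases le_total (‖y₀‖) P.R with h1 | h1
  · have : max 1 (‖y₀‖ / P.R) = 1 := max_eq_left ((div_le_one hR).2 h1)
    simp [projIter, this]
  · have hy : 0 < ‖y₀‖ := hR.trans_le h1
    have : max 1 (‖y₀‖ / P.R) = ‖y₀‖ / P.R := max_eq_right ((one_le_div hR).2 h1)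
    simp only [projIter, this, inv_div]
    refine (pow_le_pow_iff_left₀ (norm_nonneg _) (norm_nonneg _) two_ne_zero).1 ?_
    rw [norm_sub_sq_real, norm_sub_sq_real, real_inner_smul_left, norm_smul,
      Real.norm_of_nonneg (by positivity), div_mul_cancel₀ _ hy.ne']
    have h2 : inner ℝ y₀ z ≤ ‖y₀‖ * P.R :=
      (real_inner_le_norm _ _).trans (by gcongr)
    have h3 : 0 ≤ 1 - P.R / ‖y₀‖ := by
      rw [sub_nonneg, div_le_one hy]; exact h1
    have h4 : (1 - P.R / ‖y₀‖) * inner ℝ y₀ z ≤ (1 - P.R / ‖y₀‖) * (‖y₀‖ * P.R) := by gcongr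
    have h5 : (1 - P.R / ‖y₀‖) * (‖y₀‖ * P.R) = ‖y₀‖ * P.R - P.R ^ 2 := by field_simp
    -- After inserting the bound on the inner product, the squared distances differ by at least
    -- (‖y₀‖ - R)².
    nlinarith [h4, h5, sq_nonneg (‖y₀‖ - P.R)]

theorem norm_comparator_le (h : P.Admissible K) {x : Euc n} (hx : x ∈ K) :
    ‖((1 - P.δ) * P.shrink) • x‖ ≤ P.R := by
  have h1 := h.δ_lt
  have h2 := h.δ_pos
  have h3 := h.shrink_pos
  have h4 := h.shrink_le_one
  rw [norm_smul, Real.norm_of_nonneg (mul_nonneg (by linarith) h3.le)]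
  have : (1 - P.δ) * P.shrink ≤ 1 := mul_le_one₀ (by linarith) h3.le h4
  exact (mul_le_of_le_one_left (norm_nonneg _) this).trans (h.norm_le hx)

theorem norm_projIter_sub_le (h : P.Admissible K) (y₀ : Euc n) {x : Euc n} (hx : x ∈ K) (i : ℕ) :
    ‖P.projIter y₀ i - ((1 - P.δ) * P.shrink) • x‖ ≤ ‖y₀ - ((1 - P.δ) * P.shrink) • x‖ := by
  induction i with
  | zero => exact h.norm_projIter_zero_sub_le y₀ (h.norm_comparator_le hx)
  | succ i ih => exact (h.norm_pull_sub_le _ hx).trans ih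

/-- The potential argument behind both termination and the count of oracle calls: reaching iterate
`i` costs exactly `i` cuts. -/
theorem norm_projIter_sq_le (h : P.Admissible K) (y₀ : Euc n) (i : ℕ)
    (hi : ∀ j < i, ¬ P.ProjStopsAt y₀ j) :
    ‖P.projIter y₀ i‖ ^ 2 ≤ ‖y₀‖ ^ 2 - i * (P.δ * (P.r - P.δ') ^ 2) := by
  induction i with
  | zero =>
    have := h.norm_projIter_zero_sub_le y₀ (z := 0) (by simpa using h.R_pos.le)
    simp only [sub_zero] at this
    simpa using pow_le_pow_left₀ (norm_nonneg _) this 2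
  | succ i ih =>
    have h1 := ih fun j hj => hi j (by omega)
    have h2 := h.norm_pull_sq_le (hi i (by omega))
    rw [projIter]; push_cast; linarith

theorem projTerminates (h : P.Admissible K) (y₀ : Euc n) : P.ProjTerminates y₀ := by
  by_contra hcon
  have hc : 0 < P.δ * (P.r - P.δ') ^ 2 := mul_pos h.δ_pos (pow_pos (sub_pos.2 h.δ'_lt) 2)
  obtain ⟨i, hi⟩ := exists_nat_gt (‖y₀‖ ^ 2 / (P.δ * (P.r - P.δ') ^ 2))
  have h1 := h.norm_projIter_sq_le y₀ i fun j _ hj => hcon ⟨j, hj⟩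
  rw [div_lt_iff₀ hc] at hi
  nlinarith [sq_nonneg ‖P.projIter y₀ i‖]

theorem projStopsAt_projStop (h : P.Admissible K) (y₀ : Euc n) : P.ProjStopsAt y₀ (P.projStop y₀) :=
  Nat.sInf_mem (h.projTerminates y₀)

theorem projOutput_mem (h : P.Admissible K) (y₀ : Euc n) : P.shrink⁻¹ • P.projOutput y₀ ∈ K :=
  (h.ask_eq_none_iff _).1 (h.projStopsAt_projStop y₀)

theorem norm_projOutput_sub_le (h : P.Admissible K) (y₀ : Euc n) {x : Euc n} (hx : x ∈ K) :
    ‖P.projOutput y₀ - ((1 - P.δ) * P.shrink) • x‖ ≤ ‖y₀ - ((1 - P.δ) * P.shrink) • x‖ :=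
  h.norm_projIter_sub_le y₀ hx _

theorem projStop_mul_le (h : P.Admissible K) (y₀ : Euc n) :
    P.projStop y₀ * (P.δ * (P.r - P.δ') ^ 2) ≤ ‖y₀‖ ^ 2 - ‖P.projOutput y₀‖ ^ 2 := by
  have := h.norm_projIter_sq_le y₀ (P.projStop y₀) fun j hj => Nat.notMem_of_lt_sInf hj
  rw [projOutput]; linarith

theorem perturb_mem (h : P.Admissible K) {y v : Euc n} (hy : P.shrink⁻¹ • y ∈ K) (hv : ‖v‖ ≤ 1) :
    P.perturb y v ∈ K := by
  have hr := h.r_pos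
  have h1 : P.r • v ∈ K := by
    apply h.mem_of_norm_le
    rw [norm_smul, Real.norm_of_nonneg hr.le]
    exact mul_le_of_le_one_right hr.le hv
  -- y + δ'v = σ(σ⁻¹y) + (δ'/r)(rv), with weights summing to 1.
  have h2 := h.convex hy h1 h.shrink_pos.le (div_pos h.δ'_pos hr).le (by unfold shrink; ring)
  rwa [smul_inv_smul₀ h.shrink_pos.ne', smul_smul, div_mul_cancel₀ _ hr.ne'] at h2

theorem mem_of_shrink_inv_mem (h : P.Admissible K) {y : Euc n} (hy : P.shrink⁻¹ • y ∈ K) :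
    y ∈ K := by
  simpa [perturb] using h.perturb_mem hy (v := 0) (by simp)

/-- The one-point estimate uses convexity on the δ'-ball around the comparator as well, so that ball
must also lie in K. -/
theorem comparator_mem (h : P.Admissible K) {x : Euc n} (hx : x ∈ K) :
    P.shrink⁻¹ • (((1 - P.δ) * P.shrink) • x) ∈ K := by
  have h1 := h.convex hx h.zero_mem (a := 1 - P.δ) (b := P.δ) (by linarith [h.δ_lt]) h.δ_pos.le
    (by ring)
  have : P.shrink⁻¹ * ((1 - P.δ) * P.shrink) = 1 - P.δ := by
    field_simp [h.shrink_pos.ne']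
  rw [smul_smul, this]
  simpa using h1

theorem iterate_mem (h : P.Admissible K) (f : ℕ → Euc n → ℝ) (u : ℕ → Metric.sphere (0 : Euc n) 1)
    (t : ℕ) :
    P.shrink⁻¹ • P.iterate f u t ∈ K := by
  cases t with
  | zero => simpa [iterate] using h.zero_mem
  | succ t => exact h.projOutput_mem _

theorem play_mem (h : P.Admissible K) (f : ℕ → Euc n → ℝ) (u : ℕ → Metric.sphere (0 : Euc n) 1)
    (t : ℕ) :
    P.play f u t ∈ K :=
  h.perturb_mem (h.iterate_mem f u t) (norm_eq_of_mem_sphere _).le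

end Admissible
end SOBGD

/-! ### From sphere averages to directional derivatives. -/

section Sphere

open Metric Filter Topology

variable {n : ℕ}

theorem hasFDerivAt_norm_euc {x : Euc n} (hx : x ≠ 0) :
    HasFDerivAt (fun y : Euc n => ‖y‖) (‖x‖⁻¹ • innerSL ℝ x) x := by
  have h1 := (hasStrictFDerivAt_norm_sq x).hasFDerivAt.sqrt (by simpa using hx)
  have h2 : (fun y : Euc n => √(‖y‖ ^ 2)) = fun y => ‖y‖ := by
    funext y; exact Real.sqrt_sq (norm_nonneg y)
  rw [h2, Real.sqrt_sq (norm_nonneg x)] at h1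
  have h3 : ‖x‖ ≠ 0 := norm_ne_zero_iff.2 hx
  have h4 : (1 / (2 * ‖x‖)) • (2 : ℕ) • innerSL ℝ x = ‖x‖⁻¹ • innerSL ℝ x := by
    rw [← Nat.cast_smul_eq_nsmul ℝ, smul_smul]
    congr 1
    push_cast
    field_simp
  rwa [← h4]

/-- The cone `x ↦ (ρ - ‖x‖)⁺`. -/
noncomputable def coneFun (n : ℕ) (ρ : ℝ) (x : Euc n) : ℝ := max (ρ - ‖x‖) 0

theorem lipschitzWith_coneFun (ρ : ℝ) : LipschitzWith 1 (coneFun n ρ) := by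
  have h : LipschitzWith 1 fun x : Euc n => ρ - ‖x‖ :=
    LipschitzWith.of_dist_le_mul fun x y => by
      simp only [NNReal.coe_one, one_mul, dist_eq_norm]
      rw [show ρ - ‖x‖ - (ρ - ‖y‖) = -(‖x‖ - ‖y‖) by ring, norm_neg]
      exact abs_norm_sub_norm_le x y
  exact h.max_const 0

theorem hasCompactSupport_coneFun (ρ : ℝ) : HasCompactSupport (coneFun n ρ) := by
  refine HasCompactSupport.of_support_subset_isCompact (isCompact_closedBall (0 : Euc n) ρ) ?_
  intro x hx
  rw [mem_closedBall_zero_iff]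
  by_contra hcon
  exact hx (max_eq_right (by linarith))

theorem lineDeriv_coneFun_of_lt {ρ : ℝ} {x : Euc n} (hx0 : x ≠ 0) (hx : ‖x‖ < ρ) (w : Euc n) :
    lineDeriv ℝ (coneFun n ρ) x (-w) = inner ℝ x w / ‖x‖ := by
  have h1 : HasFDerivAt (coneFun n ρ) (-(‖x‖⁻¹ • innerSL ℝ x)) x := by
    refine ((hasFDerivAt_norm_euc hx0).const_sub ρ).congr_of_eventuallyEq ?_
    filter_upwards [continuous_norm.continuousAt.eventually_lt continuousAt_const hx] with y hy
    exact max_eq_left (by linarith)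
  rw [(h1.hasLineDerivAt _).lineDeriv]
  simp [div_eq_inv_mul]

theorem lineDeriv_coneFun_of_gt {ρ : ℝ} {x : Euc n} (hx : ρ < ‖x‖) (w : Euc n) :
    lineDeriv ℝ (coneFun n ρ) x w = 0 := by
  have h1 : HasFDerivAt (coneFun n ρ) (0 : Euc n →L[ℝ] ℝ) x := by
    refine (hasFDerivAt_const (0 : ℝ) x).congr_of_eventuallyEq ?_
    filter_upwards [continuousAt_const.eventually_lt continuous_norm.continuousAt hx] with y hy
    exact max_eq_right (by linarith)
  rw [(h1.hasLineDerivAt _).lineDeriv]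
  simp

/-- Integration by parts against a cone. -/
theorem integral_lineDeriv_mul_coneFun [NeZero n] {F : Euc n → ℝ} {C : NNReal}
    (hF : LipschitzWith C F) {ρ : ℝ} (hρ : 0 < ρ) (w : Euc n) :
    ∫ x, lineDeriv ℝ F x w * coneFun n ρ x = ∫ x in ball 0 ρ, inner ℝ x w / ‖x‖ * F x := by
  rw [hF.integral_lineDeriv_mul_eq (lipschitzWith_coneFun ρ) (hasCompactSupport_coneFun ρ),
    ← integral_indicator measurableSet_ball]
  apply integral_congr_ae
  -- The cone fails to be differentiable only on this sphere and at the origin, both null sets.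
  have h1 : ∀ᵐ x : Euc n, x ∉ sphere (0 : Euc n) ρ :=
    measure_eq_zero_iff_ae_notMem.1 (Measure.addHaar_sphere_of_ne_zero _ _ hρ.ne')
  have h2 : ∀ᵐ x : Euc n, x ≠ 0 := by
    simpa using measure_eq_zero_iff_ae_notMem.1
      (measure_singleton (μ := (volume : Measure (Euc n))) 0)
  filter_upwards [h1, h2] with x hx hx0
  rw [mem_sphere_zero_iff_norm] at hx
  rcases lt_or_gt_of_ne hx with h | h
  · rw [Set.indicator_of_mem (by simpa using h), lineDeriv_coneFun_of_lt hx0 h]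
  · rw [Set.indicator_of_notMem (by simpa using h.le), lineDeriv_coneFun_of_gt h, zero_mul]

/-- Polar coordinates for a function that is constant on rays. -/
theorem setIntegral_ball_comp_normalize [NeZero n] (φ : Euc n → ℝ) {ρ : ℝ} (hρ : 0 < ρ) :
    ∫ x in ball (0 : Euc n) ρ, φ (‖x‖⁻¹ • x)
      = ρ ^ n / n * ∫ u, φ u ∂(volume : Measure (Euc n)).toSphere := by
  have hn : n ≠ 0 := NeZero.ne n
  calc ∫ x in ball (0 : Euc n) ρ, φ (‖x‖⁻¹ • x)
      = ∫ x : Euc n, φ (‖x‖⁻¹ • x) * (Set.Iio ρ).indicator (fun _ => (1 : ℝ)) ‖x‖ := by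
        rw [← integral_indicator measurableSet_ball]
        congr 1; funext x
        by_cases h : ‖x‖ < ρ <;> simp [Set.indicator, h]
    _ = ∫ x : ({0}ᶜ : Set (Euc n)), φ (‖x.1‖⁻¹ • x.1)
          * (Set.Iio ρ).indicator (fun _ => (1 : ℝ)) ‖x.1‖ ∂(volume.comap Subtype.val) := by
        rw [integral_subtype_comap (measurableSet_singleton _).compl
          (fun x : Euc n => φ (‖x‖⁻¹ • x) * (Set.Iio ρ).indicator (fun _ => (1 : ℝ)) ‖x‖),
          restrict_compl_singleton]
    _ = ∫ p, φ p.1 * (Set.Iio ρ).indicator (fun _ => (1 : ℝ)) p.2.1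
          ∂(volume : Measure (Euc n)).toSphere.prod
            (.volumeIoiPow (Module.finrank ℝ (Euc n) - 1)) := by
        rw [← (volume : Measure (Euc n)).measurePreserving_homeomorphUnitSphereProd.integral_comp
          (Homeomorph.measurableEmbedding _)]
        simp
    _ = (∫ u, φ u ∂(volume : Measure (Euc n)).toSphere)
          * ∫ s : Set.Ioi (0 : ℝ),
            (Set.Iio (⟨ρ, hρ⟩ : Set.Ioi (0 : ℝ))).indicator (fun _ => (1 : ℝ)) s
            ∂(.volumeIoiPow (Module.finrank ℝ (Euc n) - 1)) := by
        rw [← integral_prod_mul]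
        rfl
    _ = _ := by
        rw [integral_indicator_const _ measurableSet_Iio, measureReal_def,
          Measure.volumeIoiPow_apply_Iio, ENNReal.toReal_ofReal (by positivity),
          finrank_euclideanSpace_fin]
        have : n - 1 + 1 = n := by omega
        have h2 : ((n - 1 : ℕ) : ℝ) + 1 = n := by exact_mod_cast this
        rw [this, h2, smul_eq_mul, mul_one, mul_comm]

theorem volume_real_ball_euc [NeZero n] {ρ : ℝ} (hρ : 0 < ρ) :
    volume.real (ball (0 : Euc n) ρ) = ρ ^ n * volume.real (ball (0 : Euc n) 1) := by
  rw [measureReal_def, Measure.addHaar_ball _ _ hρ.le, ENNReal.toReal_mul,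
    ENNReal.toReal_ofReal (by positivity), finrank_euclideanSpace_fin, measureReal_def]

/-- Subtracting the integrations by parts for the cones of radius 1 and ρ leaves an integral over
the shell ρ ≤ ‖x‖ < 1, which polar coordinates compare with the sphere integral. The last term on
the right collects shell errors of second order in 1 - ρ. -/
theorem integral_sphere_mul_inner_le_of_shell [NeZero n] {F : Euc n → ℝ} {C : NNReal}
    (hF : LipschitzWith C F) {w : Euc n} {D : ℝ}
    (hD : ∀ᵐ x : Euc n, ‖x‖ < 1 → lineDeriv ℝ F x w ≤ D) {ρ : ℝ} (hρ0 : 0 < ρ) (hρ1 : ρ < 1) :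
    (1 - ρ ^ n) / n * ∫ u : sphere (0 : Euc n) 1, inner ℝ (u : Euc n) w * F u
        ∂(volume : Measure (Euc n)).toSphere
      ≤ (1 - ρ) * (D * volume.real (ball (0 : Euc n) 1)
        + (|D| + C * ‖w‖) * ((1 - ρ ^ n) * volume.real (ball (0 : Euc n) 1))) := by
  set V := volume.real (ball (0 : Euc n) 1) with hV
  set I := ∫ u : sphere (0 : Euc n) 1, inner ℝ (u : Euc n) w * F u
        ∂(volume : Measure (Euc n)).toSphere with hI
  have hsub : ball (0 : Euc n) ρ ⊆ ball 0 1 := ball_subset_ball hρ1.le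
  have hdiff : ∀ {g : Euc n → ℝ}, IntegrableOn g (ball 0 1) →
      ∫ x in ball 0 1 \ ball 0 ρ, g x = (∫ x in ball 0 1, g x) - ∫ x in ball 0 ρ, g x :=
    fun hg => setIntegral_sdiff measurableSet_ball hg hsub
  have hvol : volume.real (ball (0 : Euc n) 1 \ ball 0 ρ) = (1 - ρ ^ n) * V := by
    rw [measureReal_sdiff hsub measurableSet_ball, volume_real_ball_euc hρ0]; ring
  have hcs : ∀ x : Euc n, |inner ℝ x w / ‖x‖| ≤ ‖w‖ := fun x => by
    rw [abs_div, abs_norm]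
    exact div_le_of_le_mul₀ (norm_nonneg _) (norm_nonneg _)
      ((abs_real_inner_le_norm x w).trans_eq (mul_comm _ _))
  have hbound : ∀ x : Euc n, ‖x‖ ≤ 1 → |F x| ≤ |F 0| + C := fun x hx => by
    have h1 := hF.dist_le_mul x 0
    rw [Real.dist_eq, dist_zero_right] at h1
    have h2 : (C : ℝ) * ‖x‖ ≤ C := mul_le_of_le_one_right C.2 hx
    have h3 := abs_sub_abs_le_abs_sub (F x) (F 0)
    linarith
  have hmeas : Measurable fun x : Euc n => inner ℝ x w / ‖x‖ := by fun_prop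
  have hFm : Measurable F := hF.continuous.measurable
  have hint1 : IntegrableOn (fun x : Euc n => inner ℝ x w / ‖x‖ * F x) (ball 0 1) := by
    refine Measure.integrableOn_of_bounded (M := ‖w‖ * (|F 0| + C)) measure_ball_lt_top.ne
      (hmeas.mul hFm).aestronglyMeasurable ?_
    filter_upwards [ae_restrict_mem measurableSet_ball] with x hx
    rw [mem_ball_zero_iff] at hx
    rw [norm_mul]
    exact mul_le_mul (hcs x) (hbound x hx.le) (norm_nonneg _) (norm_nonneg _)
  have hint2 : IntegrableOn (fun x : Euc n => inner ℝ (‖x‖⁻¹ • x) w * F (‖x‖⁻¹ • x))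
      (ball 0 1) := by
    refine Measure.integrableOn_of_bounded (M := ‖w‖ * (|F 0| + C)) measure_ball_lt_top.ne
      (by fun_prop) ?_
    filter_upwards with x
    have h1 : ‖‖x‖⁻¹ • x‖ ≤ 1 := by
      rw [norm_smul, norm_inv, norm_norm]; exact inv_mul_le_one
    rw [norm_mul]
    refine mul_le_mul ?_ (hbound _ h1) (norm_nonneg _) (norm_nonneg _)
    exact (norm_inner_le_norm _ _).trans (mul_le_of_le_one_left (norm_nonneg _) h1)
  have hpolar : ∫ x in ball 0 1 \ ball 0 ρ, inner ℝ (‖x‖⁻¹ • x) w * F (‖x‖⁻¹ • x)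
      = (1 - ρ ^ n) / n * I := by
    rw [hdiff hint2, setIntegral_ball_comp_normalize (fun y => inner ℝ y w * F y) one_pos,
      setIntegral_ball_comp_normalize (fun y => inner ℝ y w * F y) hρ0, ← hI]
    ring
  -- Radial projection moves a point of the shell by at most 1 - ρ, so replacing F(x) by its value
  -- on the sphere costs at most C(1-ρ).
  have hshell : (1 - ρ ^ n) / n * I - (1 - ρ) * (C * ‖w‖) * ((1 - ρ ^ n) * V)
      ≤ ∫ x in ball 0 1 \ ball 0 ρ, inner ℝ x w / ‖x‖ * F x := by
    have h1 : ‖∫ x in ball 0 1 \ ball 0 ρ, (inner ℝ (‖x‖⁻¹ • x) w * F (‖x‖⁻¹ • x)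
        - inner ℝ x w / ‖x‖ * F x)‖ ≤ (1 - ρ) * (C * ‖w‖) * ((1 - ρ ^ n) * V) := by
      rw [← hvol]
      refine norm_setIntegral_le_of_norm_le_const
        ((measure_mono Set.sdiff_subset).trans_lt measure_ball_lt_top) fun x hx => ?_
      have hx1 : ‖x‖ < 1 := by simpa using hx.1
      have hx2 : ρ ≤ ‖x‖ := by simpa using hx.2
      have hx0 : 0 < ‖x‖ := hρ0.trans_le hx2
      rw [real_inner_smul_left, ← div_eq_inv_mul, ← mul_sub, norm_mul]
      have h2 : ‖F (‖x‖⁻¹ • x) - F x‖ ≤ C * (1 - ρ) := by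
        refine (hF.norm_sub_le _ _).trans ?_
        gcongr
        have : ‖x‖⁻¹ • x - x = (‖x‖⁻¹ - 1) • x := by rw [sub_smul, one_smul]
        rw [this, norm_smul, Real.norm_of_nonneg
          (sub_nonneg.2 ((one_le_inv₀ hx0).2 hx1.le)), sub_mul, inv_mul_cancel₀ hx0.ne']
        linarith
      calc _ ≤ ‖w‖ * (C * (1 - ρ)) := mul_le_mul (hcs x) h2 (norm_nonneg _) (norm_nonneg _)
        _ = _ := by ring
    rw [integral_sub (hint2.mono_set Set.sdiff_subset) (hint1.mono_set Set.sdiff_subset), hpolar,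
      Real.norm_eq_abs] at h1
    linarith [le_of_abs_le h1]
  have hcone : ∀ ρ : ℝ, Integrable fun x => lineDeriv ℝ F x w * coneFun n ρ x := fun ρ => by
    have h1 : Integrable (coneFun n ρ) :=
      (lipschitzWith_coneFun ρ).continuous.integrable_of_hasCompactSupport
        (hasCompactSupport_coneFun ρ)
    refine h1.bdd_mul (c := C * ‖w‖) (measurable_lineDeriv hF.continuous).aestronglyMeasurable ?_
    filter_upwards with x
    exact norm_lineDeriv_le_of_lipschitz ℝ hF
  have hball : Integrable ((ball (0 : Euc n) 1).indicator fun _ => D) :=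
    (integrableOn_const measure_ball_lt_top.ne).integrable_indicator measurableSet_ball
  have hdif : Integrable ((ball (0 : Euc n) 1 \ ball 0 ρ).indicator fun _ => |D|) :=
    (integrableOn_const ((measure_mono Set.sdiff_subset).trans_lt
      measure_ball_lt_top).ne).integrable_indicator (measurableSet_ball.diff measurableSet_ball)
  have hup : ∫ x, (lineDeriv ℝ F x w * coneFun n 1 x - lineDeriv ℝ F x w * coneFun n ρ x)
      ≤ (1 - ρ) * (D * V + |D| * ((1 - ρ ^ n) * V)) := by
    calc _ ≤ ∫ x, (1 - ρ) * ((ball (0 : Euc n) 1).indicator (fun _ => D) x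
            + (ball (0 : Euc n) 1 \ ball 0 ρ).indicator (fun _ => |D|) x) := by
          refine integral_mono_ae ((hcone 1).sub (hcone ρ)) ((hball.add hdif).const_mul _) ?_
          filter_upwards [hD] with x hx
          rw [← mul_sub]
          rcases lt_or_ge ‖x‖ 1 with h1 | h1
          · rcases lt_or_ge ‖x‖ ρ with h2 | h2
            · have e1 : coneFun n 1 x - coneFun n ρ x = 1 - ρ := by
                rw [coneFun, coneFun, max_eq_left (by linarith), max_eq_left (by linarith)]; ring
              rw [e1, Set.indicator_of_mem (by simpa using h1),
                Set.indicator_of_notMem (by simp [h2]), add_zero, mul_comm]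
              exact mul_le_mul_of_nonneg_left (hx h1) (by linarith)
            · have e1 : coneFun n 1 x - coneFun n ρ x = 1 - ‖x‖ := by
                rw [coneFun, coneFun, max_eq_left (by linarith), max_eq_right (by linarith)]; ring
              rw [e1, Set.indicator_of_mem (by simpa using h1),
                Set.indicator_of_mem (by simp [h1, h2])]
              have h3 : lineDeriv ℝ F x w * (1 - ‖x‖) ≤ D * (1 - ‖x‖) :=
                mul_le_mul_of_nonneg_right (hx h1) (by linarith)
              -- As 0 < 1 - ‖x‖ ≤ 1 - ρ, D(1-‖x‖) ≤ (1-ρ)(D + |D|) for either sign of D.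
              nlinarith [neg_abs_le D, le_abs_self D]
          · have e1 : coneFun n 1 x - coneFun n ρ x = 0 := by
              rw [coneFun, coneFun, max_eq_right (by linarith), max_eq_right (by linarith)]; ring
            rw [e1, Set.indicator_of_notMem (by simpa using h1),
              Set.indicator_of_notMem (by simp [h1])]
            simp
      _ = _ := by
          rw [integral_const_mul, integral_add hball hdif,
            integral_indicator_const _ measurableSet_ball,
            integral_indicator_const _ (measurableSet_ball.diff measurableSet_ball), hvol,
            smul_eq_mul, smul_eq_mul]
          ring
  rw [integral_sub (hcone 1) (hcone ρ), integral_lineDeriv_mul_coneFun hF one_pos,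
    integral_lineDeriv_mul_coneFun hF hρ0, ← hdiff hint1] at hup
  linarith

/-- One-point gradient estimate for a Lipschitz function on the unit ball whose directional
derivative is bounded above. -/
theorem integral_sphere_mul_inner_le [NeZero n] {F : Euc n → ℝ} {C : NNReal}
    (hF : LipschitzWith C F) {w : Euc n} {D : ℝ}
    (hD : ∀ᵐ x : Euc n, ‖x‖ < 1 → lineDeriv ℝ F x w ≤ D) :
    ∫ u : sphere (0 : Euc n) 1, inner ℝ (u : Euc n) w * F u ∂(volume : Measure (Euc n)).toSphere
      ≤ D * volume.real (ball (0 : Euc n) 1) := by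
  set V := volume.real (ball (0 : Euc n) 1) with hV
  set I := ∫ u : sphere (0 : Euc n) 1, inner ℝ (u : Euc n) w * F u
        ∂(volume : Measure (Euc n)).toSphere with hI
  have hn : (n : ℝ) ≠ 0 := Nat.cast_ne_zero.2 (NeZero.ne n)
  -- Dividing the shell inequality by 1 - ρ turns 1 - ρⁿ into a geometric sum, which tends to n.
  have key : ∀ᶠ ρ : ℝ in 𝓝[<] 1, (∑ i ∈ Finset.range n, ρ ^ i) / n * I
      ≤ D * V + (|D| + C * ‖w‖) * ((1 - ρ ^ n) * V) := by
    filter_upwards [Ioo_mem_nhdsLT (zero_lt_one (α := ℝ))] with ρ hρ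
    have h1 := integral_sphere_mul_inner_le_of_shell hF hD hρ.1 hρ.2
    have h2 : 1 - ρ ^ n = (1 - ρ) * ∑ i ∈ Finset.range n, ρ ^ i := (mul_neg_geom_sum ρ n).symm
    have h3 : 0 < 1 - ρ := sub_pos.2 hρ.2
    refine le_of_mul_le_mul_left ?_ h3
    refine le_of_eq_of_le ?_ h1
    rw [← hI, h2]; ring
  have hl : Tendsto (fun ρ : ℝ => (∑ i ∈ Finset.range n, ρ ^ i) / n * I) (𝓝[<] 1)
      (𝓝 ((∑ i ∈ Finset.range n, (1 : ℝ) ^ i) / n * I)) :=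
    (Continuous.tendsto (by fun_prop) 1).mono_left nhdsWithin_le_nhds
  have hr : Tendsto (fun ρ : ℝ => D * V + (|D| + C * ‖w‖) * ((1 - ρ ^ n) * V)) (𝓝[<] 1)
      (𝓝 (D * V + (|D| + C * ‖w‖) * ((1 - 1 ^ n) * V))) :=
    (Continuous.tendsto (by fun_prop) 1).mono_left nhdsWithin_le_nhds
  simpa [hn] using le_of_tendsto_of_tendsto hl hr key

end Sphere

/-! ### The one-point gradient estimate. -/

theorem isProbabilityMeasure_uniformSphere {n : ℕ} [NeZero n] :
    IsProbabilityMeasure (uniformSphere n) := by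
  refine ⟨?_⟩
  rw [uniformSphere, Measure.smul_apply, smul_eq_mul]
  refine ENNReal.inv_mul_cancel ?_ (measure_ne_top _ _)
  rw [Ne, Measure.measure_univ_eq_zero]
  exact Measure.toSphere_ne_zero _

theorem integral_uniformSphere {n : ℕ} [NeZero n] (φ : Metric.sphere (0 : Euc n) 1 → ℝ) :
    ∫ u, φ u ∂uniformSphere n = (n * volume.real (Metric.ball (0 : Euc n) 1))⁻¹
      * ∫ u, φ u ∂(volume : Measure (Euc n)).toSphere := by
  rw [uniformSphere, integral_smul_measure, ENNReal.toReal_inv, ← measureReal_def,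
    Measure.toSphere_real_apply_univ, finrank_euclideanSpace_fin, smul_eq_mul]

theorem lineDeriv_le_of_convexOn {E : Type*} [AddCommGroup E] [Module ℝ E] {f : E → ℝ}
    {S : Set E} (hf : ConvexOn ℝ S f) {x w : E} (hx : x ∈ S) (hxw : x + w ∈ S)
    (hd : LineDifferentiableAt ℝ f x w) : lineDeriv ℝ f x w ≤ f (x + w) - f x := by
  let A : ℝ →ᵃ[ℝ] E := AffineMap.lineMap x (x + w)
  have hA : ∀ t, A t = x + t • w := fun t => by simp [A, AffineMap.lineMap_apply, add_comm]
  have h1 : ConvexOn ℝ (A ⁻¹' S) (f ∘ A) := hf.comp_affineMap A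
  have h2 : HasDerivAt (f ∘ A) (lineDeriv ℝ f x w) 0 := by
    have : f ∘ A = fun t : ℝ => f (x + t • w) := by funext t; simp [hA]
    rw [this]; exact hd.hasLineDerivAt
  have h3 := h1.le_slope_of_hasDerivAt (x := 0) (y := 1) (by simpa [hA] using hx)
    (by simpa [hA] using hxw) one_pos h2
  simpa [slope_def_field, hA] using h3

/-- The one-point gradient estimate of a convex Lipschitz function behaves like a subgradient, up to
an error proportional to the smoothing radius `d`. -/
theorem sub_le_integral_onePoint {n : ℕ} [NeZero n] {f : Euc n → ℝ} {G : NNReal}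
    (hf : LipschitzWith G f) {S : Set (Euc n)} (hconv : ConvexOn ℝ S f) {y z : Euc n} {d : ℝ}
    (hd : 0 < d) (hy : ∀ x : Euc n, ‖x‖ ≤ 1 → y + d • x ∈ S)
    (hz : ∀ x : Euc n, ‖x‖ ≤ 1 → z + d • x ∈ S) :
    f y - f z - 2 * G * d ≤ ∫ u : Metric.sphere (0 : Euc n) 1,
      n / d * f (y + d • (u : Euc n)) * inner ℝ (u : Euc n) (y - z) ∂uniformSphere n := by
  -- Chosen so that shifting x by `w` carries y + dx to z + dx.
  set w : Euc n := d⁻¹ • (z - y) with hw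
  have hdw : d • w = z - y := by rw [hw, smul_inv_smul₀ hd.ne']
  set F : Euc n → ℝ := fun x => f (y + d • x) with hFdef
  have hmap : LipschitzWith d.toNNReal fun x : Euc n => y + d • x :=
    LipschitzWith.of_dist_le_mul fun a b => by
      rw [dist_add_left, dist_smul₀, Real.norm_of_nonneg hd.le, Real.coe_toNNReal _ hd.le]
  have hF : LipschitzWith (G * d.toNNReal) F := hf.comp hmap
  have hn : (n : ℝ) ≠ 0 := Nat.cast_ne_zero.2 (NeZero.ne n)
  have hV : 0 < volume.real (Metric.ball (0 : Euc n) 1) :=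
    ENNReal.toReal_pos (Metric.measure_ball_pos _ _ one_pos).ne' measure_ball_lt_top.ne
  have hFconv : ConvexOn ℝ ((fun x : Euc n => y + d • x) ⁻¹' S) F := by
    let A : Euc n →ᵃ[ℝ] Euc n := AffineMap.const ℝ _ y + d • AffineMap.id ℝ _
    exact hconv.comp_affineMap A
  have hshift : ∀ x : Euc n, y + d • (x + w) = z + d • x := fun x => by
    rw [smul_add, hdw]; abel
  have hlip : ∀ (a x : Euc n), ‖x‖ ≤ 1 → |f (a + d • x) - f a| ≤ G * d := fun a x hx => by
    have h1 := hf.norm_sub_le (a + d • x) a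
    rw [add_sub_cancel_left, norm_smul, Real.norm_of_nonneg hd.le] at h1
    refine h1.trans (mul_le_mul_of_nonneg_left (mul_le_of_le_one_right hd.le hx) G.2)
  -- Lipschitz functions are differentiable along `w` almost everywhere. Convexity bounds the
  -- derivative by f(z+dx) - f(y+dx), and each value is within Gd of its center.
  have hD : ∀ᵐ x : Euc n, ‖x‖ < 1 → lineDeriv ℝ F x w ≤ f z - f y + 2 * G * d := by
    filter_upwards [hF.ae_lineDifferentiableAt (μ := volume) w] with x hx hx1
    have h1 := lineDeriv_le_of_convexOn hFconv (x := x) (w := w) (hy x hx1.le)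
      (by rw [Set.mem_preimage, hshift]; exact hz x hx1.le) hx
    have h2 := abs_le.1 (hlip y x hx1.le)
    have h3 := abs_le.1 (hlip z x hx1.le)
    simp only [hFdef, hshift] at h1
    linarith
  have key := integral_sphere_mul_inner_le hF hD
  have heq : (fun u : Metric.sphere (0 : Euc n) 1 =>
      n / d * f (y + d • (u : Euc n)) * inner ℝ (u : Euc n) (y - z))
      = fun u : Metric.sphere (0 : Euc n) 1 => (-n : ℝ) * (inner ℝ (u : Euc n) w * F u) := by
    funext u
    have : y - z = -(d • w) := by rw [hdw]; abel
    rw [this, inner_neg_right, real_inner_smul_right]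
    field_simp
    simp [hFdef, mul_comm]
  rw [heq, integral_uniformSphere, integral_const_mul, mul_inv]
  generalize (∫ u : Metric.sphere (0 : Euc n) 1, inner ℝ (u : Euc n) w * F u
    ∂(volume : Measure (Euc n)).toSphere) = I at *
  generalize volume.real (Metric.ball (0 : Euc n) 1) = V at *
  have h1 : (n : ℝ)⁻¹ * V⁻¹ * (-n * I) = -(I / V) := by field_simp
  have h2 : I / V ≤ f z - f y + 2 * G * d := (div_le_iff₀ hV).2 key
  rw [h1]; linarith

/-! ### Dependence of the run on directions and losses, measurability, independence. -/

namespace SOBGD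

variable {n : ℕ}

theorem iterate_congr_dir (P : SOBGD n) (f : ℕ → Euc n → ℝ) {u v : ℕ → Metric.sphere (0 : Euc n) 1}
    {t : ℕ} (huv : ∀ i < t, u i = v i) : P.iterate f u t = P.iterate f v t := by
  induction t with
  | zero => rfl
  | succ t ih => rw [iterate, iterate, ih fun i hi => huv i (by omega), huv t (by omega)]

namespace Admissible

variable {P : SOBGD n} {K : Set (Euc n)}

/-- Holds because every played point lies in K; this permits replacing the losses by extensions from
K. -/
theorem iterate_congr_loss (h : P.Admissible K) {f g : ℕ → Euc n → ℝ}
    (u : ℕ → Metric.sphere (0 : Euc n) 1) {t : ℕ} (hfg : ∀ i < t, ∀ x ∈ K, f i x = g i x) :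
    P.iterate f u t = P.iterate g u t := by
  induction t with
  | zero => rfl
  | succ t ih =>
    have hi := ih fun i hi => hfg i (by omega)
    have hp : f t (P.perturb (P.iterate f u t) (u t)) = g t (P.perturb (P.iterate f u t) (u t)) :=
      hfg t (by omega) _ (h.play_mem f u t)
    rw [iterate, iterate, gradStep, gradStep, ← hi, hp]

theorem measurable_pull (h : P.Admissible K) (hK : IsClosed K)
    (hso : Measurable fun y => (P.so y).getD 0) : Measurable P.pull := by
  classical
  have hset : MeasurableSet {y : Euc n | P.shrink⁻¹ • y ∈ K} :=
    (hK.preimage (continuous_const_smul _)).measurableSet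
  have hg : Measurable fun y => (P.ask y).getD 0 :=
    hso.comp (measurable_const_smul (1 - P.δ' / P.r)⁻¹)
  have heq : P.pull = fun y => if P.shrink⁻¹ • y ∈ K then y
      else y - (P.δ * (P.r - P.δ') / ‖(P.ask y).getD 0‖) • (P.ask y).getD 0 := by
    funext y
    simp only [← h.ask_eq_none_iff, pull]
    cases P.ask y <;> simp
  rw [heq]
  exact Measurable.ite hset measurable_id
    (measurable_id.sub ((measurable_const.div hg.norm).smul hg))

theorem measurable_projIter (h : P.Admissible K) (hK : IsClosed K)
    (hso : Measurable fun y => (P.so y).getD 0) (i : ℕ) :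
    Measurable fun y => P.projIter y i := by
  induction i with
  | zero => simp only [projIter]; fun_prop
  | succ i ih => exact (h.measurable_pull hK hso).comp ih

theorem measurable_projOutput (h : P.Admissible K) (hK : IsClosed K)
    (hso : Measurable fun y => (P.so y).getD 0) : Measurable P.projOutput := by
  classical
  have hp : ∀ i, MeasurableSet {y | P.ProjStopsAt y i} := fun i => by
    simp only [ProjStopsAt, h.ask_eq_none_iff]
    exact ((h.measurable_projIter hK hso i).const_smul P.shrink⁻¹) hK.measurableSet
  have hex : ∀ y, ∃ i, P.ProjStopsAt y i := h.projTerminates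
  have heq : P.projOutput = fun y => P.projIter y (Nat.find (hex y)) := by
    funext y
    have : P.projStop y = Nat.find (hex y) := by
      rw [projStop]
      exact Nat.sInf_def (s := {i | P.ProjStopsAt y i}) (hex y)
    rw [projOutput, this]
  rw [heq]
  exact Measurable.find (h.measurable_projIter hK hso) hp hex

theorem measurable_iterate (h : P.Admissible K) (hK : IsClosed K)
    (hso : Measurable fun y => (P.so y).getD 0) {f : ℕ → Euc n → ℝ} (hf : ∀ t, Measurable (f t))
    (t : ℕ) : Measurable fun u => P.iterate f u t := by
  induction t with
  | zero => exact measurable_const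
  | succ t ih =>
    refine (h.measurable_projOutput hK hso).comp ?_
    have hu : Measurable fun u : ℕ → Metric.sphere (0 : Euc n) 1 => (u t : Euc n) :=
      measurable_subtype_coe.comp (measurable_pi_apply t)
    simp only [gradStep, perturb]
    have := hf t
    fun_prop

variable {Ω : Type*} {T : ℕ} {u : ℕ → Ω → Metric.sphere (0 : Euc n) 1}

/-- The iterate of round `t` as a function of the directions of the earlier rounds. -/
theorem exists_iterate_factor (h : P.Admissible K) (hK : IsClosed K)
    (hso : Measurable fun y => (P.so y).getD 0) {f : ℕ → Euc n → ℝ} (hf : ∀ t, Measurable (f t))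
    [Nonempty Ω] (u : ℕ → Ω → Metric.sphere (0 : Euc n) 1) {t : ℕ} (ht : t < T) :
    ∃ φ : (Finset.Iio (⟨t, ht⟩ : Fin T) → Metric.sphere (0 : Euc n) 1) → Euc n,
      Measurable φ ∧ ∀ ω, P.iterate f (fun i => u i ω) t = φ fun i => u i ω := by
  classical
  obtain ⟨ω₀⟩ := ‹Nonempty Ω›
  -- Directions from round `t` on do not influence the iterate and are filled with an arbitrary
  -- constant.
  let ext (v : Finset.Iio (⟨t, ht⟩ : Fin T) → Metric.sphere (0 : Euc n) 1)
      (i : ℕ) : Metric.sphere (0 : Euc n) 1 :=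
    if hi : i < t then v ⟨⟨i, hi.trans ht⟩, by simpa using hi⟩ else u 0 ω₀
  have hext : Measurable ext := by
    refine measurable_pi_lambda _ fun i => ?_
    by_cases hi : i < t
    · simp only [ext, hi, dite_true]; exact measurable_pi_apply _
    · simp only [ext, hi, dite_false]; exact measurable_const
  refine ⟨fun v => P.iterate f (ext v) t, (h.measurable_iterate hK hso hf t).comp hext, fun ω => ?_⟩
  exact P.iterate_congr_dir f fun i hi => by simp [ext, hi]

variable [MeasurableSpace Ω] {μ : Measure Ω}

theorem measurable_iterate_comp (h : P.Admissible K) (hK : IsClosed K)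
    (hso : Measurable fun y => (P.so y).getD 0) {f : ℕ → Euc n → ℝ} (hf : ∀ t, Measurable (f t))
    [Nonempty Ω] (hu : ∀ t < T, Measurable (u t)) {t : ℕ} (ht : t < T) :
    Measurable fun ω => P.iterate f (fun i => u i ω) t := by
  obtain ⟨φ, hφ, he⟩ := h.exists_iterate_factor hK hso hf u ht
  simp only [he]
  exact hφ.comp (measurable_pi_lambda _ fun i => hu _ i.1.2)

theorem indepFun_iterate (h : P.Admissible K) (hK : IsClosed K)
    (hso : Measurable fun y => (P.so y).getD 0) {f : ℕ → Euc n → ℝ} (hf : ∀ t, Measurable (f t))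
    [Nonempty Ω] (hu : ∀ t < T, Measurable (u t)) (hind : iIndepFun (fun t : Fin T => u t) μ)
    {t : ℕ} (ht : t < T) : IndepFun (fun ω => P.iterate f (fun i => u i ω) t) (u t) μ := by
  classical
  obtain ⟨φ, hφ, he⟩ := h.exists_iterate_factor hK hso hf u ht
  have h1 := hind.indepFun_finset (Finset.Iio ⟨t, ht⟩) {⟨t, ht⟩}
    (by simp) fun i => hu i i.2
  have h2 := h1.comp hφ (measurable_pi_apply ⟨⟨t, ht⟩, by simp⟩)
  convert h2 using 1
  · funext ω
    exact he ω
  · rfl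

end Admissible
end SOBGD

/-! ### Call count and expected regret for general parameters. -/

namespace SOBGD

variable {n : ℕ}

/-- The inner product of the gradient estimate of round `t` with `ỹ - z`. -/
noncomputable def linearizedLoss (P : SOBGD n) (f : ℕ → Euc n → ℝ)
    (u : ℕ → Metric.sphere (0 : Euc n) 1) (z : Euc n) (t : ℕ) : ℝ :=
  n / P.δ' * f t (P.play f u t) * inner ℝ (u t : Euc n) (P.iterate f u t - z)

namespace Admissible

variable {P : SOBGD n} {K : Set (Euc n)} {T : ℕ} {f : ℕ → Euc n → ℝ} {M : ℝ}

theorem norm_iterate_succ_sub_sq (h : P.Admissible K)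
    (hM : ∀ t < T, ∀ x ∈ K, |f t x| ≤ M) (u : ℕ → Metric.sphere (0 : Euc n) 1) {x : Euc n}
    (hx : x ∈ K) {t : ℕ} (ht : t < T) :
    ‖P.iterate f u (t + 1) - ((1 - P.δ) * P.shrink) • x‖ ^ 2
      ≤ ‖P.iterate f u t - ((1 - P.δ) * P.shrink) • x‖ ^ 2
        - 2 * P.η * P.linearizedLoss f u (((1 - P.δ) * P.shrink) • x) t
        + P.η ^ 2 * (n / P.δ' * M) ^ 2 :=
  (pow_le_pow_left₀ (norm_nonneg _) (h.norm_projOutput_sub_le _ hx) 2).trans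
    (P.norm_gradStep_sub_sq _ _ _ (hM t ht _ (h.play_mem f u t)))

/-- Telescoping from an arbitrary start `s`: all iterates stay in RB, so the first term is at most
(2R)² whatever `s` is. This makes the regret bound adaptive. -/
theorem sum_linearizedLoss_le (h : P.Admissible K)
    (hM : ∀ t < T, ∀ x ∈ K, |f t x| ≤ M) (u : ℕ → Metric.sphere (0 : Euc n) 1) {x : Euc n}
    (hx : x ∈ K) {s e : ℕ} (hse : s ≤ e) (he : e ≤ T) :
    2 * P.η * ∑ t ∈ Finset.Ico s e, P.linearizedLoss f u (((1 - P.δ) * P.shrink) • x) t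
      ≤ ‖P.iterate f u s - ((1 - P.δ) * P.shrink) • x‖ ^ 2
        - ‖P.iterate f u e - ((1 - P.δ) * P.shrink) • x‖ ^ 2
        + (e - s) * (P.η ^ 2 * (n / P.δ' * M) ^ 2) := by
  induction e, hse using Nat.le_induction with
  | base => simp
  | succ e hse ih =>
    have h1 := ih (by omega)
    have h2 := h.norm_iterate_succ_sub_sq hM u hx (t := e) (by omega)
    rw [Finset.sum_Ico_succ_top hse, mul_add]
    push_cast
    linarith

theorem abs_linearizedLoss_le (h : P.Admissible K) (hM : ∀ t < T, ∀ x ∈ K, |f t x| ≤ M)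
    (u : ℕ → Metric.sphere (0 : Euc n) 1) {z : Euc n} (hz : ‖z‖ ≤ P.R) {t : ℕ} (ht : t < T) :
    |P.linearizedLoss f u z t| ≤ n / P.δ' * M * (2 * P.R) := by
  have hd := h.δ'_pos
  have h1 : ‖P.iterate f u t - z‖ ≤ 2 * P.R := by
    have := h.norm_le (h.mem_of_shrink_inv_mem (h.iterate_mem f u t))
    linarith [norm_sub_le (P.iterate f u t) z]
  have h2 : |inner ℝ (u t : Euc n) (P.iterate f u t - z)| ≤ 2 * P.R := by
    refine (abs_real_inner_le_norm _ _).trans ?_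
    rwa [norm_eq_of_mem_sphere, one_mul]
  have h3 := hM t ht _ (h.play_mem f u t)
  rw [linearizedLoss, abs_mul, abs_mul, abs_of_nonneg (by positivity : (0 : ℝ) ≤ n / P.δ')]
  gcongr
  exact mul_nonneg (by positivity) ((abs_nonneg _).trans h3)

/-- ‖ỹ‖² starts at 0 and stays nonnegative; a gradient step raises it by at most `B` and every cut
lowers it by at least δ(r-δ')². The first summand T counts the final, certifying call of each round.
-/
theorem calls_le (h : P.Admissible K) (hη : 0 < P.η)
    (hM : ∀ t < T, ∀ x ∈ K, |f t x| ≤ M) (u : ℕ → Metric.sphere (0 : Euc n) 1) :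
    (P.calls f u T : ℝ) ≤ T + T * (2 * P.η * (n / P.δ' * M * P.R)
      + P.η ^ 2 * (n / P.δ' * M) ^ 2) / (P.δ * (P.r - P.δ') ^ 2) := by
  have hd := h.δ'_pos
  have hc : 0 < P.δ * (P.r - P.δ') ^ 2 := mul_pos h.δ_pos (pow_pos (sub_pos.2 h.δ'_lt) 2)
  set B := 2 * P.η * (n / P.δ' * M * P.R) + P.η ^ 2 * (n / P.δ' * M) ^ 2 with hB
  have key : ∀ k ≤ T, (∑ t ∈ Finset.range k, (P.projStop (P.target f u t) : ℝ))
      * (P.δ * (P.r - P.δ') ^ 2) ≤ k * B - ‖P.iterate f u k‖ ^ 2 := by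
    intro k
    induction k with
    | zero => intro _; simp [iterate]
    | succ k ih =>
      intro hk
      have h1 := ih (by omega)
      have h2 := h.projStop_mul_le (P.target f u k)
      have h3 : ‖P.target f u k‖ ^ 2 ≤ ‖P.iterate f u k‖ ^ 2
          - 2 * P.η * P.linearizedLoss f u 0 k + P.η ^ 2 * (n / P.δ' * M) ^ 2 := by
        have := P.norm_gradStep_sub_sq (φ := f k) (P.iterate f u k) 0 (u k)
          (hM k (by omega) _ (h.play_mem f u k))
        simpa only [sub_zero, linearizedLoss, target, play] using this
      have h4 : -P.linearizedLoss f u 0 k ≤ n / P.δ' * M * P.R := by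
        refine (neg_le_abs _).trans ?_
        have h5 := hM k (by omega) _ (h.play_mem f u k)
        rw [linearizedLoss, sub_zero, abs_mul, abs_mul,
          abs_of_nonneg (by positivity : (0 : ℝ) ≤ n / P.δ')]
        have h6 : |inner ℝ (u k : Euc n) (P.iterate f u k)| ≤ P.R := by
          refine (abs_real_inner_le_norm _ _).trans ?_
          rw [norm_eq_of_mem_sphere, one_mul]
          exact h.norm_le (h.mem_of_shrink_inv_mem (h.iterate_mem f u k))
        gcongr
        exact mul_nonneg (by positivity) ((abs_nonneg _).trans h5)
      have h7 : P.iterate f u (k + 1) = P.projOutput (P.target f u k) := rfl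
      rw [Finset.sum_range_succ, add_mul, h7]
      push_cast
      nlinarith [mul_le_mul_of_nonneg_left h4 hη.le]
  have h1 : (P.calls f u T : ℝ)
      = T + ∑ t ∈ Finset.range T, (P.projStop (P.target f u t) : ℝ) := by
    simp [calls, projCalls, Finset.sum_add_distrib, add_comm]
  rw [h1]
  gcongr
  rw [le_div_iff₀ hc]
  linarith [key T le_rfl, sq_nonneg ‖P.iterate f u T‖]

variable {Ω : Type*} [MeasurableSpace Ω] {u : ℕ → Ω → Metric.sphere (0 : Euc n) 1} {G : NNReal}

theorem measurable_play (h : P.Admissible K) (hK : IsClosed K)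
    (hso : Measurable fun y => (P.so y).getD 0) (hf : ∀ t, Measurable (f t))
    [Nonempty Ω] (hu : ∀ t < T, Measurable (u t)) {t : ℕ} (ht : t < T) :
    Measurable fun ω => P.play f (fun i => u i ω) t :=
  (h.measurable_iterate_comp hK hso hf hu ht).add
    ((measurable_subtype_coe.comp (hu t ht)).const_smul P.δ')

variable {μ : Measure Ω} [IsProbabilityMeasure μ]

theorem integrable_loss_play (h : P.Admissible K) (hK : IsClosed K)
    (hso : Measurable fun y => (P.so y).getD 0) (hf : ∀ t, Measurable (f t))
    (hM : ∀ t < T, ∀ x ∈ K, |f t x| ≤ M) (hu : ∀ t < T, Measurable (u t)) {t : ℕ} (ht : t < T) :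
    Integrable (fun ω => f t (P.play f (fun i => u i ω) t)) μ :=
  have : Nonempty Ω := nonempty_of_isProbabilityMeasure μ
  Integrable.of_bound
    ((hf t).comp (h.measurable_play hK hso hf hu ht)).aestronglyMeasurable M
    (ae_of_all _ fun _ => hM t ht _ (h.play_mem f _ t))

theorem integrable_linearizedLoss (h : P.Admissible K) (hK : IsClosed K)
    (hso : Measurable fun y => (P.so y).getD 0) (hf : ∀ t, Measurable (f t))
    (hM : ∀ t < T, ∀ x ∈ K, |f t x| ≤ M) (hu : ∀ t < T, Measurable (u t)) {z : Euc n}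
    (hz : ‖z‖ ≤ P.R) {t : ℕ} (ht : t < T) :
    Integrable (fun ω => P.linearizedLoss f (fun i => u i ω) z t) μ := by
  have : Nonempty Ω := nonempty_of_isProbabilityMeasure μ
  refine Integrable.of_bound (Measurable.aestronglyMeasurable ?_) (n / P.δ' * M * (2 * P.R))
    (ae_of_all _ fun ω => h.abs_linearizedLoss_le hM _ hz ht)
  exact (((hf t).comp (h.measurable_play hK hso hf hu ht)).const_mul _).mul
    ((measurable_subtype_coe.comp (hu t ht)).inner
      ((h.measurable_iterate_comp hK hso hf hu ht).sub_const z))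

/-- In expectation, the linearized loss dominates the loss difference of the iterate and a
comparator, up to the smoothing error. -/
theorem integral_loss_iterate_le [NeZero n] (h : P.Admissible K) (hK : IsClosed K)
    (hso : Measurable fun y => (P.so y).getD 0) (hf : ∀ t, LipschitzWith G (f t))
    (hconv : ∀ t < T, ConvexOn ℝ K (f t)) (hM : ∀ t < T, ∀ x ∈ K, |f t x| ≤ M)
    (hu : ∀ t < T, Measurable (u t)) (hlaw : ∀ t < T, μ.map (u t) = uniformSphere n)
    (hind : iIndepFun (fun t : Fin T => u t) μ) {z : Euc n} (hz : P.shrink⁻¹ • z ∈ K)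
    {t : ℕ} (ht : t < T) :
    ∫ ω, f t (P.iterate f (fun i => u i ω) t) ∂μ
      ≤ f t z + 2 * G * P.δ' + ∫ ω, P.linearizedLoss f (fun i => u i ω) z t ∂μ := by
  have : Nonempty Ω := nonempty_of_isProbabilityMeasure μ
  have := isProbabilityMeasure_uniformSphere (n := n)
  have hfm : ∀ t, Measurable (f t) := fun t => (hf t).continuous.measurable
  have hY := h.measurable_iterate_comp hK hso hfm hu ht
  set Y : Ω → Euc n := fun ω => P.iterate f (fun i => u i ω) t with hYdef
  have hYprob : IsProbabilityMeasure (μ.map Y) := Measure.isProbabilityMeasure_map hY.aemeasurable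
  let H : Euc n × Metric.sphere (0 : Euc n) 1 → ℝ := fun p =>
    n / P.δ' * f t (p.1 + P.δ' • (p.2 : Euc n)) * inner ℝ (p.2 : Euc n) (p.1 - z)
  have hH : Measurable H := by
    have := (hf t).continuous
    exact Continuous.measurable (by fun_prop)
  have hpair : Measurable fun ω => (Y ω, u t ω) := hY.prodMk (hu t ht)
  -- Independence makes the joint law a product, so Fubini allows the one-point estimate to be
  -- applied at each fixed iterate `y`.
  have hmap : μ.map (fun ω => (Y ω, u t ω)) = (μ.map Y).prod (uniformSphere n) := by
    rw [← hlaw t ht]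
    exact (indepFun_iff_map_prod_eq_prod_map_map hY.aemeasurable (hu t ht).aemeasurable).1
      (h.indepFun_iterate hK hso hfm hu hind ht)
  have hint : Integrable (fun ω => H (Y ω, u t ω)) μ :=
    h.integrable_linearizedLoss hK hso hfm hM hu (h.norm_le (h.mem_of_shrink_inv_mem hz)) ht
  have hint' : Integrable H ((μ.map Y).prod (uniformSphere n)) := by
    rw [← hmap]
    exact (integrable_map_measure hH.aestronglyMeasurable hpair.aemeasurable).2 hint
  have hYint : Integrable (fun ω => f t (Y ω)) μ :=
    Integrable.of_bound ((hfm t).comp hY).aestronglyMeasurable M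
      (ae_of_all _ fun ω => hM t ht _ (h.mem_of_shrink_inv_mem (h.iterate_mem f _ t)))
  have hYint' : Integrable (f t) (μ.map Y) :=
    (integrable_map_measure (hfm t).aestronglyMeasurable hY.aemeasurable).2 hYint
  have hset : MeasurableSet {y : Euc n | P.shrink⁻¹ • y ∈ K} :=
    (hK.preimage (continuous_const_smul _)).measurableSet
  have hae : ∀ᵐ y ∂μ.map Y, P.shrink⁻¹ • y ∈ K :=
    (ae_map_iff hY.aemeasurable hset).2 (ae_of_all _ fun ω => h.iterate_mem f _ t)
  have key : ∫ y, (f t y - (f t z + 2 * G * P.δ')) ∂μ.map Y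
      ≤ ∫ y, ∫ v, H (y, v) ∂uniformSphere n ∂μ.map Y := by
    refine integral_mono_ae (hYint'.sub (integrable_const _))
      hint'.integral_prod_left ?_
    filter_upwards [hae] with y hy
    rw [← sub_sub]
    exact sub_le_integral_onePoint (hf t) (hconv t ht) h.δ'_pos
      (fun x hx => h.perturb_mem hy hx) (fun x hx => h.perturb_mem hz hx)
  rw [← integral_prod _ hint', ← hmap, integral_map hpair.aemeasurable hH.aestronglyMeasurable,
    integral_map hY.aemeasurable (by fun_prop), integral_sub hYint (integrable_const _)] at key
  simp only [integral_const, probReal_univ, one_smul] at key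
  have heq : ∫ ω, P.linearizedLoss f (fun i => u i ω) z t ∂μ = ∫ ω, H (Y ω, u t ω) ∂μ := rfl
  rw [heq]
  linarith

/-- Shrinking moves `x` by (δ + δ'/r - δδ'/r)‖x‖, and the negative product is dropped. -/
theorem loss_comparator_le (h : P.Admissible K) {φ : Euc n → ℝ} (hφ : LipschitzWith G φ)
    {x : Euc n} (hx : x ∈ K) :
    φ (((1 - P.δ) * P.shrink) • x) ≤ φ x + G * P.R * (P.δ + P.δ' / P.r) := by
  have h1 := hφ.norm_sub_le (((1 - P.δ) * P.shrink) • x) x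
  have hs : 0 ≤ P.δ' / P.r := (div_pos h.δ'_pos h.r_pos).le
  have hc : 1 - (1 - P.δ) * P.shrink = P.δ + P.δ' / P.r - P.δ * (P.δ' / P.r) := by
    unfold shrink; ring
  have h2 : ‖((1 - P.δ) * P.shrink) • x - x‖ ≤ (P.δ + P.δ' / P.r) * P.R := by
    have e : ((1 - P.δ) * P.shrink) • x - x = -((1 - (1 - P.δ) * P.shrink) • x) := by
      rw [sub_smul, one_smul]; abel
    have h3 : 0 ≤ P.δ * (P.δ' / P.r) := mul_nonneg h.δ_pos.le hs
    have h4 : P.δ * (P.δ' / P.r) ≤ P.δ' / P.r := mul_le_of_le_one_left hs h.δ_lt.le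
    have h5 := h.δ_pos
    rw [e, norm_neg, norm_smul, hc, Real.norm_of_nonneg (by linarith)]
    have h6 := h.norm_le hx
    gcongr
    linarith
  have h3 : (G : ℝ) * ‖((1 - P.δ) * P.shrink) • x - x‖ ≤ G * ((P.δ + P.δ' / P.r) * P.R) :=
    mul_le_mul_of_nonneg_left h2 G.2
  have h4 := (le_abs_self _).trans h1
  linarith

/-- Of the 3Gδ' per round, one Gδ' comes from passing from the play to the iterate and two from the
one-point estimate. -/
theorem integral_sum_loss_le [NeZero n] (h : P.Admissible K) (hK : IsClosed K) (hη : 0 < P.η)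
    (hso : Measurable fun y => (P.so y).getD 0) (hf : ∀ t, LipschitzWith G (f t))
    (hconv : ∀ t < T, ConvexOn ℝ K (f t)) (hM : ∀ t < T, ∀ x ∈ K, |f t x| ≤ M)
    (hu : ∀ t < T, Measurable (u t)) (hlaw : ∀ t < T, μ.map (u t) = uniformSphere n)
    (hind : iIndepFun (fun t : Fin T => u t) μ) {x : Euc n} (hx : x ∈ K) {s e : ℕ}
    (hse : s ≤ e) (he : e ≤ T) :
    ∫ ω, ∑ t ∈ Finset.Ico s e, f t (P.play f (fun i => u i ω) t) ∂μ
      ≤ ∑ t ∈ Finset.Ico s e, f t x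
        + T * (3 * G * P.δ' + G * P.R * (P.δ + P.δ' / P.r) + P.η / 2 * (n / P.δ' * M) ^ 2)
        + 2 * P.R ^ 2 / P.η := by
  have : Nonempty Ω := nonempty_of_isProbabilityMeasure μ
  have hfm : ∀ t, Measurable (f t) := fun t => (hf t).continuous.measurable
  set z := ((1 - P.δ) * P.shrink) • x with hz
  have hzR : ‖z‖ ≤ P.R := h.norm_comparator_le hx
  set A := 3 * G * P.δ' + G * P.R * (P.δ + P.δ' / P.r) with hA
  -- Nonnegativity allows the cost over a shorter interval to be bounded by that of all T rounds.
  have hA0 : 0 ≤ A := by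
    have h1 := h.δ'_pos
    have h2 := h.δ_pos
    have h3 := h.R_pos
    have h4 := h.r_pos
    positivity
  have hint : ∀ t ∈ Finset.Ico s e, Integrable (fun ω => f t (P.play f (fun i => u i ω) t)) μ :=
    fun t ht => h.integrable_loss_play hK hso hfm hM hu ((Finset.mem_Ico.1 ht).2.trans_le he)
  have hlin : ∀ t ∈ Finset.Ico s e,
      Integrable (fun ω => P.linearizedLoss f (fun i => u i ω) z t) μ :=
    fun t ht => h.integrable_linearizedLoss hK hso hfm hM hu hzR
      ((Finset.mem_Ico.1 ht).2.trans_le he)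
  have hround : ∀ t ∈ Finset.Ico s e, ∫ ω, f t (P.play f (fun i => u i ω) t) ∂μ
      ≤ f t x + A + ∫ ω, P.linearizedLoss f (fun i => u i ω) z t ∂μ := by
    intro t ht
    have htT : t < T := (Finset.mem_Ico.1 ht).2.trans_le he
    have hY := h.measurable_iterate_comp hK hso hfm hu htT
    have hYint : Integrable (fun ω => f t (P.iterate f (fun i => u i ω) t)) μ :=
      Integrable.of_bound ((hfm t).comp hY).aestronglyMeasurable M
        (ae_of_all _ fun ω => hM t htT _ (h.mem_of_shrink_inv_mem (h.iterate_mem f _ t)))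
    have h1 := h.integral_loss_iterate_le hK hso hf hconv hM hu hlaw hind
      (h.comparator_mem hx) htT
    have h2 : ∫ ω, f t (P.play f (fun i => u i ω) t) ∂μ
        ≤ ∫ ω, (f t (P.iterate f (fun i => u i ω) t) + G * P.δ') ∂μ := by
      refine integral_mono (hint t ht) (hYint.add (integrable_const _)) fun ω => ?_
      have h3 := (hf t).norm_sub_le (P.play f (fun i => u i ω) t) (P.iterate f (fun i => u i ω) t)
      rw [play, perturb, add_sub_cancel_left, norm_smul, norm_eq_of_mem_sphere, mul_one,
        Real.norm_of_nonneg h.δ'_pos.le, Real.norm_eq_abs] at h3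
      have h4 := (le_abs_self _).trans h3
      simp only [play, perturb]
      linarith
    rw [integral_add hYint (integrable_const _)] at h2
    simp only [integral_const, probReal_univ, one_smul] at h2
    have h5 := h.loss_comparator_le (hf t) hx
    rw [hA]
    linarith
  have hsum : ∑ t ∈ Finset.Ico s e, ∫ ω, P.linearizedLoss f (fun i => u i ω) z t ∂μ
      ≤ 2 * P.R ^ 2 / P.η + T * (P.η / 2 * (n / P.δ' * M) ^ 2) := by
    rw [← integral_finsetSum _ hlin]
    have hb : ∀ ω, ∑ t ∈ Finset.Ico s e, P.linearizedLoss f (fun i => u i ω) z t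
        ≤ 2 * P.R ^ 2 / P.η + T * (P.η / 2 * (n / P.δ' * M) ^ 2) := fun ω => by
      have h1 := h.sum_linearizedLoss_le hM (fun i => u i ω) hx hse he
      have h2 : ‖P.iterate f (fun i => u i ω) s - z‖ ≤ 2 * P.R := by
        have := h.norm_le (h.mem_of_shrink_inv_mem (h.iterate_mem f (fun i => u i ω) s))
        linarith [norm_sub_le (P.iterate f (fun i => u i ω) s) z]
      have h3 : ‖P.iterate f (fun i => u i ω) s - z‖ ^ 2 ≤ (2 * P.R) ^ 2 :=
        pow_le_pow_left₀ (norm_nonneg _) h2 2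
      have h4 : ((e : ℝ) - s) * (P.η ^ 2 * (n / P.δ' * M) ^ 2)
          ≤ T * (P.η ^ 2 * (n / P.δ' * M) ^ 2) := by
        gcongr
        have : (e : ℝ) ≤ T := by exact_mod_cast he
        have : (0 : ℝ) ≤ s := by positivity
        linarith
      have h5 : 2 * P.η * (2 * P.R ^ 2 / P.η + T * (P.η / 2 * (n / P.δ' * M) ^ 2))
          = (2 * P.R) ^ 2 + T * (P.η ^ 2 * (n / P.δ' * M) ^ 2) := by
        field_simp
      refine le_of_mul_le_mul_left ?_ (mul_pos two_pos hη)
      rw [h5]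
      linarith [sq_nonneg ‖P.iterate f (fun i => u i ω) e - z‖]
    calc _ ≤ ∫ _, (2 * P.R ^ 2 / P.η + T * (P.η / 2 * (n / P.δ' * M) ^ 2)) ∂μ :=
          integral_mono (integrable_finsetSum _ hlin) (integrable_const _) hb
      _ = _ := by simp
  rw [integral_finsetSum _ hint]
  have hcount : ∑ _t ∈ Finset.Ico s e, A ≤ T * A := by
    rw [Finset.sum_const, Nat.card_Ico, nsmul_eq_mul]
    gcongr
    exact_mod_cast (Nat.sub_le e s).trans he
  calc _ ≤ ∑ t ∈ Finset.Ico s e,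
        (f t x + A + ∫ ω, P.linearizedLoss f (fun i => u i ω) z t ∂μ) := Finset.sum_le_sum hround
    _ ≤ _ := by
      rw [Finset.sum_add_distrib, Finset.sum_add_distrib]
      linarith

end Admissible
end SOBGD

/-! ### Assembling the guarantee; reduction to globally Lipschitz losses. -/

namespace SOBGD

variable {n : ℕ} {P : SOBGD n} {K : Set (Euc n)} {T : ℕ} {f : ℕ → Euc n → ℝ} {M : ℝ}
  {Ω : Type*} [MeasurableSpace Ω] {μ : Measure Ω} {u : ℕ → Ω → Metric.sphere (0 : Euc n) 1}

theorem Guarantee.mono {a b a' b' : ℝ} (h : P.Guarantee μ K f u T a b) (ha : a ≤ a')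
    (hb : b ≤ b') : P.Guarantee μ K f u T a' b' :=
  ⟨h.terminates, h.feasible, fun ω => (h.calls_le ω).trans hb, h.integrable, h.regret_le.trans ha⟩

/-- The losses enter a run only through their values on the feasible set. -/
theorem Admissible.guarantee_congr {g : ℕ → Euc n → ℝ} {a b : ℝ} (h : P.Admissible K)
    (hfg : ∀ t < T, ∀ x ∈ K, f t x = g t x) (hg : P.Guarantee μ K g u T a b) :
    P.Guarantee μ K f u T a b := by
  have hplay : ∀ ω, ∀ t < T, P.play f (fun i => u i ω) t = P.play g (fun i => u i ω) t := by
    intro ω t ht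
    rw [play, play, h.iterate_congr_loss _ fun i hi => hfg i (hi.trans ht)]
  have htarget : ∀ ω, ∀ t < T,
      P.target f (fun i => u i ω) t = P.target g (fun i => u i ω) t := by
    intro ω t ht
    have h1 := h.iterate_congr_loss (t := t) (fun i => u i ω) fun i hi => hfg i (hi.trans ht)
    have h2 := hfg t ht _ (h.play_mem g (fun i => u i ω) t)
    rw [play] at h2
    rw [target, target, h1, gradStep, gradStep, h2]
  have hloss : ∀ t < T, (fun ω => f t (P.play f (fun i => u i ω) t))
      = fun ω => g t (P.play g (fun i => u i ω) t) := fun t ht => by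
    funext ω
    rw [hplay ω t ht, hfg t ht _ (h.play_mem g _ t)]
  refine ⟨fun _ _ _ => h.projTerminates _, fun _ _ _ => h.play_mem _ _ _, fun ω => ?_,
    fun t ht => ?_, ?_⟩
  · refine le_of_eq_of_le ?_ (hg.calls_le ω)
    rw [calls, calls]
    congr 1
    exact Finset.sum_congr rfl fun t ht => by rw [htarget ω t (Finset.mem_range.1 ht)]
  · rw [hloss t ht]; exact hg.integrable t ht
  · refine le_of_eq_of_le ?_ hg.regret_le
    rw [adaptiveExpectedRegret, adaptiveExpectedRegret]
    congr 1
    funext I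
    congr 1
    · congr 1
      funext ω
      exact Finset.sum_congr rfl fun t _ => congrFun (hloss t t.2) ω
    · congr 1
      funext x
      exact Finset.sum_congr rfl fun t _ => hfg t t.2 x x.2

variable [IsProbabilityMeasure μ]

theorem Admissible.guarantee_of_lipschitzWith [NeZero n] {G : NNReal} (h : P.Admissible K)
    (hK : IsClosed K) (hη : 0 < P.η) (hT : 1 ≤ T)
    (hso : Measurable fun y => (P.so y).getD 0) (hf : ∀ t, LipschitzWith G (f t))
    (hconv : ∀ t < T, ConvexOn ℝ K (f t)) (hM : ∀ t < T, ∀ x ∈ K, |f t x| ≤ M)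
    (hu : ∀ t < T, Measurable (u t)) (hlaw : ∀ t < T, μ.map (u t) = uniformSphere n)
    (hind : iIndepFun (fun t : Fin T => u t) μ) :
    P.Guarantee μ K f u T
      (T * (3 * G * P.δ' + G * P.R * (P.δ + P.δ' / P.r) + P.η / 2 * (n / P.δ' * M) ^ 2)
        + 2 * P.R ^ 2 / P.η)
      (T + T * (2 * P.η * (n / P.δ' * M * P.R)
        + P.η ^ 2 * (n / P.δ' * M) ^ 2) / (P.δ * (P.r - P.δ') ^ 2)) where
  terminates _ _ _ := h.projTerminates _
  feasible _ _ _ := h.play_mem _ _ _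
  calls_le _ := h.calls_le hη hM _
  integrable _ ht :=
    h.integrable_loss_play hK hso (fun t => (hf t).continuous.measurable) hM hu ht
  regret_le := by
    have : Nonempty {p : Fin T × Fin T // p.1 ≤ p.2} := ⟨⟨(⟨0, hT⟩, ⟨0, hT⟩), le_rfl⟩⟩
    have : Nonempty K := ⟨⟨0, h.zero_mem⟩⟩
    refine ciSup_le fun ⟨⟨s, e⟩, hse⟩ => ?_
    have hsum : ∀ g : ℕ → ℝ, ∑ t ∈ Finset.Icc s e, g t = ∑ t ∈ Finset.Ico (s : ℕ) (e + 1), g t :=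
      fun g => by
        have h1 : Finset.Ico (s : ℕ) (e + 1) = (Finset.Icc s e).map Fin.valEmbedding := by
          rw [Fin.map_valEmbedding_Icc]; rfl
        rw [h1, Finset.sum_map]; rfl
    -- With the infimum isolated on the right, it suffices to treat each comparator `x`.
    rw [sub_le_comm]
    refine le_ciInf fun x => ?_
    rw [hsum fun t => f t x]
    have hplay : ∀ ω, ∑ t ∈ Finset.Icc s e, f t (P.play f (fun i => u i ω) t)
        = ∑ t ∈ Finset.Ico (s : ℕ) (e + 1), f t (P.play f (fun i => u i ω) t) :=
      fun ω => hsum fun t => f t (P.play f (fun i => u i ω) t)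
    simp only [hplay]
    have h1 := h.integral_sum_loss_le hK hη hso hf hconv hM hu hlaw hind x.2
      (s := s) (e := e + 1) (Nat.le_succ_of_le hse) e.2
    linarith

/-- Each loss is extended from K to a Lipschitz function on the whole space with the same constant.
The extension need not be convex outside K, and convexity is only used on K. -/
theorem Admissible.guarantee [NeZero n] {G : ℝ} (h : P.Admissible K)
    (hK : IsClosed K) (hη : 0 < P.η) (hT : 1 ≤ T) (hG : 0 ≤ G)
    (hso : Measurable fun y => (P.so y).getD 0)
    (hconv : ∀ t < T, ConvexOn ℝ K (f t)) (hM : ∀ t < T, ∀ x ∈ K, |f t x| ≤ M)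
    (hlip : ∀ t < T, ∀ x ∈ K, ∀ y ∈ K, |f t x - f t y| ≤ G * ‖x - y‖)
    (hu : ∀ t < T, Measurable (u t)) (hlaw : ∀ t < T, μ.map (u t) = uniformSphere n)
    (hind : iIndepFun (fun t : Fin T => u t) μ) :
    P.Guarantee μ K f u T
      (T * (3 * G * P.δ' + G * P.R * (P.δ + P.δ' / P.r) + P.η / 2 * (n / P.δ' * M) ^ 2)
        + 2 * P.R ^ 2 / P.η)
      (T + T * (2 * P.η * (n / P.δ' * M * P.R)
        + P.η ^ 2 * (n / P.δ' * M) ^ 2) / (P.δ * (P.r - P.δ') ^ 2)) := by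
  have hex : ∀ t, ∃ g : Euc n → ℝ, LipschitzWith G.toNNReal g ∧ (t < T → Set.EqOn (f t) g K) := by
    intro t
    by_cases ht : t < T
    · have h1 : LipschitzOnWith G.toNNReal (f t) K :=
        LipschitzOnWith.of_dist_le_mul fun x hx y hy => by
        rw [Real.dist_eq, dist_eq_norm, Real.coe_toNNReal _ hG]
        exact hlip t ht x hx y hy
      obtain ⟨g, hg, he⟩ := h1.extend_real
      exact ⟨g, hg, fun _ => he⟩
    · exact ⟨fun _ => 0, LipschitzWith.const' 0, fun h => absurd h ht⟩
  choose g hg hfg using hex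
  have := h.guarantee_of_lipschitzWith hK hη hT hso hg
    (fun t ht => (hconv t ht).congr (hfg t ht))
    (fun t ht x hx => hfg t ht hx ▸ hM t ht x hx) hu hlaw hind
  rw [Real.coe_toNNReal _ hG] at this
  exact h.guarantee_congr (fun t ht x hx => hfg t ht hx) this

end SOBGD

/-! ### Tuning the parameters, with a = T^(1/4) and q = √(nM). -/

theorem tuned_regret_bound {a q r R G c c' : ℝ} (ha : 0 < a) (hr : 0 < r)
    (hR : 0 < R) (hG : 0 ≤ G) (hc : 0 < c) (hc' : 0 < c') :
    a ^ 4 * (3 * G * (c' * a⁻¹) + G * R * (c * a⁻¹ + c' * a⁻¹ / r)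
        + r / (4 * q) * (a ^ 3)⁻¹ / 2 * (q ^ 2 / (c' * a⁻¹)) ^ 2)
        + 2 * R ^ 2 / (r / (4 * q) * (a ^ 3)⁻¹)
      ≤ (3 * G * c' + G * R * c' / r + G * R * c + 8 * R ^ 2 * q / r
        + q ^ 3 * r / (8 * c' ^ 2)) * a ^ 3 + G * R * (c * c' / r) * a ^ 2 := by
  have h1 : a ^ 4 * (3 * G * (c' * a⁻¹) + G * R * (c * a⁻¹ + c' * a⁻¹ / r)
        + r / (4 * q) * (a ^ 3)⁻¹ / 2 * (q ^ 2 / (c' * a⁻¹)) ^ 2)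
        + 2 * R ^ 2 / (r / (4 * q) * (a ^ 3)⁻¹)
      = (3 * G * c' + G * R * c' / r + G * R * c + 8 * R ^ 2 * q / r
        + q ^ 3 * r / (8 * c' ^ 2)) * a ^ 3 := by
    field_simp
    ring
  rw [h1]
  -- The a³ terms already match exactly; the a² term of the bound is slack.
  have : 0 ≤ G * R * (c * c' / r) * a ^ 2 := by positivity
  linarith

theorem tuned_call_bound {a q r R c c' : ℝ} (ha : 0 < a) (hq : 0 < q) (hr : 0 < r)
    (hR : 0 < R) (hc : 0 < c) (hc' : 0 < c') (hca : c * a⁻¹ < 1) (hca' : 2 * c' * a⁻¹ < r) :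
    a ^ 4 * (2 * (r / (4 * q) * (a ^ 3)⁻¹) * (q ^ 2 / (c' * a⁻¹) * R)
        + (r / (4 * q) * (a ^ 3)⁻¹) ^ 2 * (q ^ 2 / (c' * a⁻¹)) ^ 2)
        / (c * a⁻¹ * (r - c' * a⁻¹) ^ 2)
      ≤ 2 * R * q / r * (1 / (c * c')) * a ^ 3 + q ^ 2 / 4 * (1 / (c ^ 2 * c' ^ 2)) * a ^ 2 := by
  -- The condition 2δ' < r bounds the denominator, while c ≤ a (from δ < 1) turns the factor c·a of
  -- the second term into a².
  have h1 : (r / 2) ^ 2 ≤ (r - c' * a⁻¹) ^ 2 := by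
    apply pow_le_pow_left₀ (by positivity); linarith
  have h2 : c ≤ a := by
    have := (mul_lt_mul_iff_left₀ ha).2 hca
    rw [mul_assoc, inv_mul_cancel₀ ha.ne'] at this
    linarith
  calc _ ≤ a ^ 4 * (2 * (r / (4 * q) * (a ^ 3)⁻¹) * (q ^ 2 / (c' * a⁻¹) * R)
        + (r / (4 * q) * (a ^ 3)⁻¹) ^ 2 * (q ^ 2 / (c' * a⁻¹)) ^ 2)
        / (c * a⁻¹ * (r / 2) ^ 2) := by gcongr
    _ = 2 * R * q / r * (1 / (c * c')) * a ^ 3 + q ^ 2 / 4 * (1 / (c ^ 2 * c' ^ 2)) * (c * a) := by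
      field_simp
      ring
    _ ≤ _ := by
      gcongr
      rw [sq]; gcongr

theorem mainTheorem3 {n : ℕ} (hn : 1 ≤ n) {T : ℕ} (hT : 1 ≤ T)
    {K : Set (Euc n)} (hKconv : Convex ℝ K) (hKcomp : IsCompact K)
    {r R M G : ℝ} (hr : 0 < r) (hR : 0 < R) (hM : 0 < M)
    (hrK : Metric.closedBall 0 r ⊆ K) (hKR : K ⊆ Metric.closedBall 0 R)
    {so : Euc n → Option (Euc n)} (hso : IsSeparationOracle K so)
    (hso_meas : Measurable fun y => (so y).getD 0)
    {f : ℕ → Euc n → ℝ}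
    (hf_conv : ∀ t < T, ConvexOn ℝ (Metric.closedBall 0 R) (f t))
    (hf_bdd : ∀ t < T, ∀ x ∈ Metric.closedBall (0 : Euc n) R, |f t x| ≤ M)
    (hf_lip : ∀ t < T, ∀ x ∈ Metric.closedBall (0 : Euc n) R,
      ∀ y ∈ Metric.closedBall (0 : Euc n) R, |f t x - f t y| ≤ G * ‖x - y‖)
    {Ω : Type*} [MeasurableSpace Ω] {μ : Measure Ω} [IsProbabilityMeasure μ]
    {u : ℕ → Ω → Metric.sphere (0 : Euc n) 1}
    (hu_meas : ∀ t < T, Measurable (u t))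
    (hu_law : ∀ t < T, μ.map (u t) = uniformSphere n)
    (hu_indep : iIndepFun (fun (t : Fin T) => u t) μ) :
    (∀ c c' : ℝ, 0 < c → 0 < c' →
      2 * c' * (T : ℝ) ^ (-(1 / 4) : ℝ) < r → c * (T : ℝ) ^ (-(1 / 4) : ℝ) < 1 →
      (tunedSOBGD so r R M T c c').Guarantee μ K f u T
        ((3 * G * c' + G * R * c' / r + G * R * c + 8 * R ^ 2 * √(n * M) / r
            + (n * M) ^ (3 / 2 : ℝ) * r / (8 * c' ^ 2)) * (T : ℝ) ^ (3 / 4 : ℝ)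
          + G * R * (c * c' / r) * (T : ℝ) ^ (1 / 2 : ℝ))
        (T + 2 * R * √(n * M) / r * (1 / (c * c')) * (T : ℝ) ^ (3 / 4 : ℝ)
          + n * M / 4 * (1 / (c ^ 2 * c' ^ 2)) * (T : ℝ) ^ (1 / 2 : ℝ))) ∧
    (max (2 * √(n * M) / r) (8 / r) < (T : ℝ) ^ (1 / 4 : ℝ) →
      (tunedSOBGD so r R M T (8 / r) √(n * M)).Guarantee μ K f u T
        (R * √(n * M) * (4 * G / r + 8 * R / r + r / (8 * R)) * (T : ℝ) ^ (3 / 4 : ℝ)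
          + 8 * G * R / r * (T : ℝ) ^ (3 / 4 : ℝ)
          + G * R * (8 * √(n * M) / r ^ 2) * (T : ℝ) ^ (1 / 2 : ℝ))
        (T + R / 4 * (T : ℝ) ^ (3 / 4 : ℝ) + r ^ 2 / 256 * (T : ℝ) ^ (1 / 2 : ℝ))) := by
  have : NeZero n := ⟨by omega⟩
  have hT0 : (0 : ℝ) < T := by exact_mod_cast hT
  have hnM : 0 < n * M := mul_pos (by exact_mod_cast hn) hM
  set q := √(n * M) with hq
  have hq0 : 0 < q := Real.sqrt_pos.2 hnM
  have hq2 : n * M = q ^ 2 := (Real.sq_sqrt hnM.le).symm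
  set a := (T : ℝ) ^ (1 / 4 : ℝ) with ha
  have ha0 : 0 < a := Real.rpow_pos_of_pos hT0 _
  have hpow : ∀ k : ℕ, a ^ k = (T : ℝ) ^ ((1 / 4 : ℝ) * k) := fun k => by
    rw [ha, Real.rpow_mul_natCast hT0.le]
  have e4 : (T : ℝ) = a ^ 4 := by rw [hpow]; norm_num
  have e3 : (T : ℝ) ^ (3 / 4 : ℝ) = a ^ 3 := by rw [hpow]; norm_num
  have e2 : (T : ℝ) ^ (1 / 2 : ℝ) = a ^ 2 := by rw [hpow]; norm_num
  have em1 : (T : ℝ) ^ (-(1 / 4) : ℝ) = a⁻¹ := Real.rpow_neg hT0.le _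
  have em3 : (T : ℝ) ^ (-(3 / 4) : ℝ) = (a ^ 3)⁻¹ := by rw [Real.rpow_neg hT0.le, e3]
  have eq3 : (n * M) ^ (3 / 2 : ℝ) = q ^ 3 := by
    rw [hq, Real.sqrt_eq_rpow, ← Real.rpow_mul_natCast hnM.le]; norm_num
  -- A vector of norm r, available since n ≥ 1, yields both r ≤ R and G ≥ 0.
  obtain ⟨x₀, hx₀⟩ : ∃ x : Euc n, ‖x‖ = r := exists_norm_eq (Euc n) hr.le
  have hrR : r ≤ R := by
    have := hKR (hrK (mem_closedBall_zero_iff.2 hx₀.le))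
    rwa [mem_closedBall_zero_iff, hx₀] at this
  have hG : 0 ≤ G := by
    have h1 := hf_lip 0 hT x₀ (mem_closedBall_zero_iff.2 (hx₀.le.trans hrR)) 0
      (by simpa using hR.le)
    rw [sub_zero, hx₀] at h1
    exact nonneg_of_mul_nonneg_left ((abs_nonneg _).trans h1) hr
  have main : ∀ c c' : ℝ, 0 < c → 0 < c' → 2 * c' * a⁻¹ < r → c * a⁻¹ < 1 →
      (tunedSOBGD so r R M T c c').Guarantee μ K f u T
        ((3 * G * c' + G * R * c' / r + G * R * c + 8 * R ^ 2 * q / r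
            + q ^ 3 * r / (8 * c' ^ 2)) * a ^ 3 + G * R * (c * c' / r) * a ^ 2)
        (T + 2 * R * q / r * (1 / (c * c')) * a ^ 3
          + q ^ 2 / 4 * (1 / (c ^ 2 * c' ^ 2)) * a ^ 2) := by
    intro c c' hc hc' h1 h2
    have hδ' : 0 < c' * a⁻¹ := by positivity
    have hP : (tunedSOBGD so r R M T c c').Admissible K := by
      refine ⟨hKconv, hso, hr, hR, ?_, ?_, ?_, ?_, hrK, hKR⟩
      · simp only [tunedSOBGD, em1]; positivity
      · simpa only [tunedSOBGD, em1] using h2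
      · simpa only [tunedSOBGD, em1] using hδ'
      · simp only [tunedSOBGD, em1]; linarith
    have hη : 0 < (tunedSOBGD so r R M T c c').η := by
      simp only [tunedSOBGD, em3, ← hq]; positivity
    have hdiv : n / (c' * a⁻¹) * M = q ^ 2 / (c' * a⁻¹) := by rw [← hq2]; ring
    refine (hP.guarantee hKcomp.isClosed hη hT hG hso_meas
      (fun t ht => (hf_conv t ht).subset hKR hKconv)
      (fun t ht x hx => hf_bdd t ht x (hKR hx))
      (fun t ht x hx y hy => hf_lip t ht x (hKR hx) y (hKR hy))
      hu_meas hu_law hu_indep).mono ?_ ?_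
    · simp only [tunedSOBGD, em1, em3, ← hq, hdiv]
      rw [e4]
      exact tuned_regret_bound ha0 hr hR hG hc hc'
    · simp only [tunedSOBGD, em1, em3, ← hq, hdiv]
      rw [add_assoc]
      gcongr
      rw [e4]
      exact tuned_call_bound ha0 hq0 hr hR hc hc' h2 h1
  rw [e3, e2, em1, eq3, hq2]
  refine ⟨main, fun hmax => ?_⟩
  obtain ⟨h1, h2⟩ := max_lt_iff.1 hmax
  have h1' : 2 * q * a⁻¹ < r := by
    rw [← div_eq_mul_inv, div_lt_iff₀ ha0]
    rwa [div_lt_iff₀ hr, mul_comm a] at h1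
  have h2' : 8 / r * a⁻¹ < 1 := by rwa [← div_eq_mul_inv, div_lt_one ha0]
  refine (main (8 / r) q (by positivity) hq0 h1' h2').mono ?_ (le_of_eq ?_)
  -- By r ≤ R the term 3Gc' merges with GRc'/r, giving the constant 4G/r.
  · have h3 : 3 * G * q ≤ 3 * (G * R * q / r) := by
      have : G * q ≤ G * R * q / r := by
        rw [le_div_iff₀ hr]
        have := mul_le_mul_of_nonneg_left hrR (mul_nonneg hG hq0.le)
        linarith
      linarith
    have h4 : R * q * (4 * G / r + 8 * R / r + r / (8 * R)) * a ^ 3 + 8 * G * R / r * a ^ 3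
          + G * R * (8 * q / r ^ 2) * a ^ 2
        = (3 * (G * R * q / r) + G * R * q / r + G * R * (8 / r) + 8 * R ^ 2 * q / r
          + q ^ 3 * r / (8 * q ^ 2)) * a ^ 3 + G * R * (8 / r * q / r) * a ^ 2 := by
      field_simp
      ring
    rw [h4]
    gcongr
  · field_simp
    ring
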